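/- Let $\mathbb{F}_4$ be the field with four elements, and let $\mathbb{S}_4=\mathbb{F}_4[X]/(X^2)$, $\mathbb{T}_4=\mathbb{F}_4[X;a\mapsto a^2]/(X^2)$ (the truncated skew polynomial ring with $Xa=a^2X$) and $\mathbb{G}_4=\mathbb{Z}_4[X]/(X^2+X+1)$. For a ring $R$ among these, let $\mathrm{PHG}(2,R)$ be the right projective Hjelmslev plane over $R$: its points (lines) are the free submodules of rank $1$ (rank $2$) of the right module $R^3_R$, and incidence is inclusion. A multiset of points is a map $K$ from the set $\mathcal{P}$ of points to $\mathbb{N}_0$; it is projective if it only takes the values $0$ and $1$; the multiplicity of a line $L$ is $K(L)=\sum_{x\subseteq L}K(x)$. A $(k,n)$-arc is a multiset $K$ of points with $\sum_{x\in\mathcal P}K(x)=k$ and $K(L)\le n$ for every line $L$, and $\mathrm{m}_n(R)$ is the largest $k$ for which a projective $(k,n)$-arc in $\mathrm{PHG}(2,R)$ exists. A dual hyperoval is a $(21,2)$-arc in the dual plane, i.e. a multiset of $21$ lines such that every point lies on at most two of them (counted with multiplicity). **Theorem.** 1. $\mathrm{m}_8(\mathbb{S}_4)\le 125$ and $\mathrm{m}_8(\mathbb{T}_4)\le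 125$. 2. $\mathrm{m}_8(\mathbb{G}_4)=126$. 3. For $R\in\{\mathbb{S}_4,\mathbb{T}_4,\mathbb{G}_4\}$, every $(126,8)$-arc $K$ in $\mathrm{PHG}(2,R)$ is projective and satisfies $K(L)\in\{0,8\}$ for every line $L$, and the set of lines $L$ with $K(L)=0$ is a dual hyperoval. 4. There is no dual hyperoval in $\mathrm{PHG}(2,\mathbb{S}_4)$ or in $\mathrm{PHG}(2,\mathbb{T}_4)$. -/

import Mathlib

open scoped Polynomial

namespace Hjelmslev

noncomputable section

/-! ## The rings -/

/-- The truncated skew polynomial ring `F[X; σ]/(X²)`: the pair `(a, b)` stands for `a + b X`,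
where `X² = 0` and `X a = σ(a) X`. -/
@[ext]
structure TruncSkewPoly (F : Type*) [Field F] (σ : F →+* F) where
  const : F
  lin : F

namespace TruncSkewPoly

variable {F : Type*} [Field F] {σ : F →+* F}

instance : Zero (TruncSkewPoly F σ) := ⟨⟨0, 0⟩⟩
instance : One (TruncSkewPoly F σ) := ⟨⟨1, 0⟩⟩
instance : Add (TruncSkewPoly F σ) := ⟨fun x y => ⟨x.const + y.const, x.lin + y.lin⟩⟩
instance : Neg (TruncSkewPoly F σ) := ⟨fun x => ⟨-x.const, -x.lin⟩⟩
instance : Mul (TruncSkewPoly F σ) :=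
  ⟨fun x y => ⟨x.const * y.const, x.const * y.lin + x.lin * σ y.const⟩⟩

@[simp] theorem zero_const : (0 : TruncSkewPoly F σ).const = 0 := rfl
@[simp] theorem zero_lin : (0 : TruncSkewPoly F σ).lin = 0 := rfl
@[simp] theorem one_const : (1 : TruncSkewPoly F σ).const = 1 := rfl
@[simp] theorem one_lin : (1 : TruncSkewPoly F σ).lin = 0 := rfl
@[simp] theorem add_const (x y : TruncSkewPoly F σ) : (x + y).const = x.const + y.const := rfl
@[simp] theorem add_lin (x y : TruncSkewPoly F σ) : (x + y).lin = x.lin + y.lin := rfl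
@[simp] theorem neg_const (x : TruncSkewPoly F σ) : (-x).const = -x.const := rfl
@[simp] theorem neg_lin (x : TruncSkewPoly F σ) : (-x).lin = -x.lin := rfl
@[simp] theorem mul_const (x y : TruncSkewPoly F σ) : (x * y).const = x.const * y.const := rfl
@[simp] theorem mul_lin (x y : TruncSkewPoly F σ) :
    (x * y).lin = x.const * y.lin + x.lin * σ y.const := rfl

instance : Ring (TruncSkewPoly F σ) where
  add_assoc x y z := by ext <;> simp [add_assoc]
  zero_add x := by ext <;> simp
  add_zero x := by ext <;> simp
  add_comm x y := by ext <;> simp [add_comm]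
  neg_add_cancel x := by ext <;> simp
  mul_assoc x y z := by ext <;> simp <;> ring
  one_mul x := by ext <;> simp
  mul_one x := by ext <;> simp
  left_distrib x y z := by ext <;> simp <;> ring
  right_distrib x y z := by ext <;> simp <;> ring
  zero_mul x := by ext <;> simp
  mul_zero x := by ext <;> simp
  nsmul := nsmulRec
  zsmul := zsmulRec

instance [Finite F] : Finite (TruncSkewPoly F σ) :=
  Finite.of_injective (fun x => (x.const, x.lin)) fun x y h => by
    rw [Prod.mk.injEq] at h
    exact TruncSkewPoly.ext h.1 h.2

/-- The embedding of the scalars. -/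
def C : F →+* TruncSkewPoly F σ where
  toFun a := ⟨a, 0⟩
  map_one' := rfl
  map_zero' := rfl
  map_mul' a b := by ext <;> simp
  map_add' a b := by ext <;> simp

/-- The class of the indeterminate. -/
def X : TruncSkewPoly F σ := ⟨0, 1⟩

@[simp] theorem C_const (a : F) : (C a : TruncSkewPoly F σ).const = a := rfl
@[simp] theorem C_lin (a : F) : (C a : TruncSkewPoly F σ).lin = 0 := rfl
@[simp] theorem X_const : (X : TruncSkewPoly F σ).const = 0 := rfl
@[simp] theorem X_lin : (X : TruncSkewPoly F σ).lin = 1 := rfl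

theorem X_sq : (X : TruncSkewPoly F σ) ^ 2 = 0 := by
  rw [sq]; ext <;> simp

theorem X_mul_C (a : F) : (X : TruncSkewPoly F σ) * C a = C (σ a) * X := by
  ext <;> simp

theorem eq_C_add_C_mul_X (x : TruncSkewPoly F σ) : x = C x.const + C x.lin * X := by
  ext <;> simp

/-- The universal property of `F[X; σ]/(X²)`: a ring homomorphism out of it is the same as a
ring homomorphism `f` on `F` and an element `t` with `t² = 0` and `t f(a) = f(σ(a)) t`. -/
theorem existsUnique_hom {A : Type*} [Ring A] (f : F →+* A) (t : A) (ht : t ^ 2 = 0)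
    (hft : ∀ a, t * f a = f (σ a) * t) :
    ∃! g : TruncSkewPoly F σ →+* A, (∀ a, g (C a) = f a) ∧ g X = t := by
  rw [sq] at ht
  refine ⟨{ toFun := fun x => f x.const + f x.lin * t
            map_one' := by simp
            map_zero' := by simp
            map_add' := fun x y => by simp only [add_const, add_lin, map_add]; noncomm_ring
            map_mul' := fun x y => ?_ }, ⟨fun a => by simp, by simp⟩, ?_⟩
  · have h1 : f x.lin * t * f y.const = f x.lin * f (σ y.const) * t := by
      rw [mul_assoc, hft, mul_assoc]
    have h2 : f x.lin * t * (f y.lin * t) = 0 := by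
      rw [mul_assoc, ← mul_assoc t, hft, mul_assoc (f _) t t, ht, mul_zero, mul_zero]
    rw [add_mul, mul_add, mul_add, h1, h2]
    simp only [mul_const, mul_lin, map_add, map_mul]
    noncomm_ring
  · rintro g ⟨hC, hX⟩
    ext x
    conv_lhs => rw [eq_C_add_C_mul_X x]
    simp [hC, hX]

end TruncSkewPoly

/-- The field with four elements. -/
abbrev F4 : Type := GaloisField 2 2

/-- `𝕊₄ = 𝔽₄[X]/(X²)`. -/
abbrev S4 : Type := TruncSkewPoly F4 (RingHom.id F4)

/-- `𝕋₄ = 𝔽₄[X; a ↦ a²]/(X²)`. -/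
abbrev T4 : Type := TruncSkewPoly F4 (frobenius F4 2)

/-- The Galois ring `𝔾₄ = ℤ₄[X]/(X² + X + 1)`. -/
abbrev G4 : Type := AdjoinRoot (Polynomial.X ^ 2 + Polynomial.X + 1 : (ZMod 4)[X])

instance : Finite G4 := by
  have hm : (Polynomial.X ^ 2 + Polynomial.X + 1 : (ZMod 4)[X]).Monic := by monicity!
  have : Module.Finite (ZMod 4) G4 := hm.finite_adjoinRoot
  exact Module.finite_of_finite (ZMod 4)

/-! ## The right projective Hjelmslev plane over a ring -/

/-- The free submodules of rank `k` of the free right module `R³`; right `R`-modules are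
modules over `Rᵐᵒᵖ`. -/
def FreeSubmodule (R : Type*) [Ring R] (k : ℕ) : Type _ :=
  {M : Submodule Rᵐᵒᵖ (Fin 3 → R) // Nonempty (Module.Basis (Fin k) Rᵐᵒᵖ M)}

instance (R : Type*) [Ring R] [Finite R] (k : ℕ) : Finite (FreeSubmodule R k) :=
  haveI : Finite (Submodule Rᵐᵒᵖ (Fin 3 → R)) :=
    Finite.of_injective (fun M => (M : Set (Fin 3 → R))) SetLike.coe_injective
  inferInstanceAs (Finite (Subtype _))

/-- The points of `PHG(2, R)`. -/
abbrev Point (R : Type*) [Ring R] : Type _ := FreeSubmodule R 1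

/-- The lines of `PHG(2, R)`. -/
abbrev Line (R : Type*) [Ring R] : Type _ := FreeSubmodule R 2

/-- The incidence relation of `PHG(2, R)`. -/
def Inc (R : Type*) [Ring R] (x : Point R) (l : Line R) : Prop := x.1 ≤ l.1

/-- The incidence relation of the dual plane, whose points are the lines of `PHG(2, R)` and
whose lines are the points of `PHG(2, R)`. -/
def DualInc (R : Type*) [Ring R] (l : Line R) (x : Point R) : Prop := Inc R x l

/-! ## Arcs in (finite) incidence structures -/

section Arcs

variable {P L : Type*}

/-- The multiplicity `K(l)` of a line `l` in a multiset `K` of points. -/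
def lineMult (I : P → L → Prop) (K : P → ℕ) (l : L) : ℕ := ∑ᶠ (x : P) (_ : I x l), K x

/-- `K` is a `(k, n)`-arc. -/
structure IsArc (I : P → L → Prop) (K : P → ℕ) (k n : ℕ) : Prop where
  size_eq : ∑ᶠ x, K x = k
  lineMult_le : ∀ l, lineMult I K l ≤ n

/-- `K` is projective, i.e. it is the characteristic function of a set of points. -/
def IsProjective (K : P → ℕ) : Prop := ∀ x, K x = 0 ∨ K x = 1

/-- The set of the sizes `k` of projective `(k, n)`-arcs. -/
def arcSizes (I : P → L → Prop) (n : ℕ) : Set ℕ :=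
  {k | ∃ K : P → ℕ, IsProjective K ∧ IsArc I K k n}

/-- The largest size of a projective `(k, n)`-arc. -/
def maxArcSize (I : P → L → Prop) (n : ℕ) : ℕ := sSup (arcSizes I n)

theorem isGreatest_maxArcSize [Finite P] (I : P → L → Prop) (n : ℕ) :
    IsGreatest (arcSizes I n) (maxArcSize I n) := by
  have hne : (arcSizes I n).Nonempty :=
    ⟨0, fun _ => 0, fun _ => Or.inl rfl, by simp, fun l => by simp [lineMult]⟩
  have hbd : BddAbove (arcSizes I n) := by
    refine ⟨Nat.card P, ?_⟩
    rintro k ⟨K, hK, hk⟩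
    have := Fintype.ofFinite P
    rw [← hk.size_eq, finsum_eq_sum_of_fintype, Nat.card_eq_fintype_card, Fintype.card,
      Finset.card_eq_sum_ones]
    exact Finset.sum_le_sum fun x _ => by rcases hK x with h | h <;> simp [h]
  exact ⟨Nat.sSup_mem hne hbd, fun k hk => le_csSup hbd hk⟩

end Arcs

/-- `m_n(R)`: the largest size of a projective `(k, n)`-arc in `PHG(2, R)`. -/
def m (n : ℕ) (R : Type*) [Ring R] : ℕ := maxArcSize (Inc R) n

/-- A dual hyperoval of `PHG(2, R)`, `R` of cardinality `16`: a hyperoval, that is a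
`(21, 2)`-arc, of the dual plane. -/
def IsDualHyperoval (R : Type*) [Ring R] (H : Line R → ℕ) : Prop := IsArc (DualInc R) H 21 2

/-- The characteristic function of the set of the empty lines of `K`. -/
def emptyLines (R : Type*) [Ring R] (K : Point R → ℕ) : Line R → ℕ :=
  Set.indicator {l | lineMult (Inc R) K l = 0} 1

/-- Every `(126, 8)`-arc of `PHG(2, R)` is projective and meets every line in `0` or `8` points,
and its empty lines form a dual hyperoval. -/
def ArcsAreDualHyperovals (R : Type*) [Ring R] : Prop :=
  ∀ K : Point R → ℕ, IsArc (Inc R) K 126 8 →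
    IsProjective K ∧
    (∀ l : Line R, lineMult (Inc R) K l = 0 ∨ lineMult (Inc R) K l = 8) ∧
    IsDualHyperoval R (emptyLines R K)

end

end Hjelmslev

/-! The theorem combines a counting argument with an obstruction for lifts. In coordinates, each
plane has 21 neighbour classes of points; 20 lines pass through a point, and two distinct points
have 4 common lines if they are neighbours and 1 otherwise. Adding the multiplicities of the lines
through x gives k + 3u + 16K(x) ≤ 20n, where u is the multiplicity of the class of x
(`Coordinates.sum_lineMult_through`). For n = 8 and k ≥ 126 this forces K ≤ 1, u = 6 for every
class, k = 126 and equality at every point of K. Hence lines are empty or full, and the empty ones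
form a dual hyperoval. Conversely, the same count for (21, 2) in the dual plane shows that the
points on no line of a dual hyperoval form a (126, 8)-arc. Everything is thus reduced to the
existence of dual hyperovals.

Over 𝕊₄ and 𝕋₄ the residue map has a section by a subring. A dual hyperoval picks one line in each
class, hence a homogeneous map g on V = 𝔽₄³, and non-concurrency says that Δ(u, v) = ⟨g(u) + g(v) +
g(u+v), σ(u × v)⟩ is nonzero for independent u, v. A nowhere additive homogeneous function on a
plane is linear plus a multiple of a²b² (`dot_combination`), so Δ(u, v) = Q(u × v) for a function Q
that is nonzero off 0. Q sums to zero over Fano subplanes (`form_fano`), and its sums over affine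
lines depend only on the direction (`sum_form_line`). Hence Q is a sum of three functions of two
coordinates with constant marginals, and Q³ sums to 0 over V (`K4.sum_cube_eq_zero`). But Q³ = 1 at
the 63 nonzero vectors, a contradiction.

Over 𝔾₄ a dual hyperoval comes from the Teichmüller units of the cubic extension
(`Galois.no_three_concurrent`). -/

namespace Hjelmslev

/-! ## A computable field with four elements -/

/-- The field with four elements; `(a, b)` stands for `a + b ω` with `ω² = ω + 1`. -/
def K4 : Type := Bool × Bool

namespace K4

instance : DecidableEq K4 := inferInstanceAs (DecidableEq (Bool × Bool))
instance : Fintype K4 := inferInstanceAs (Fintype (Bool × Bool))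
instance : Zero K4 := ⟨(false, false)⟩
instance : One K4 := ⟨(true, false)⟩
instance : Add K4 := ⟨fun a b => (xor a.1 b.1, xor a.2 b.2)⟩
instance : Neg K4 := ⟨fun a => a⟩
instance : Mul K4 := ⟨fun a b => (xor (a.1 && b.1) (a.2 && b.2),
  xor (a.1 && b.2) (xor (a.2 && b.1) (a.2 && b.2)))⟩
-- Nonzero elements satisfy a³ = 1.
instance : Inv K4 := ⟨fun a => a * a⟩

/-- A generator of the multiplicative group. -/
def ω : K4 := (false, true)

theorem forall_iff {p : K4 → Prop} : (∀ x, p x) ↔ p 0 ∧ p 1 ∧ p ω ∧ p (ω * ω) := by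
  refine ⟨fun h => ⟨h _, h _, h _, h _⟩, ?_⟩
  rintro ⟨h0, h1, h2, h3⟩ ⟨_ | _, _ | _⟩
  exacts [h0, h2, h1, h3]

theorem exists_iff {p : K4 → Prop} : (∃ x, p x) ↔ p 0 ∨ p 1 ∨ p ω ∨ p (ω * ω) := by
  refine ⟨?_, ?_⟩
  · rintro ⟨⟨_ | _, _ | _⟩, h⟩
    exacts [Or.inl h, Or.inr (Or.inr (Or.inl h)), Or.inr (Or.inl h), Or.inr (Or.inr (Or.inr h))]
  · rintro (h | h | h | h) <;> exact ⟨_, h⟩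

instance decidableForall (p : K4 → Prop) [DecidablePred p] : Decidable (∀ x, p x) :=
  decidable_of_iff' _ forall_iff

instance decidableExists (p : K4 → Prop) [DecidablePred p] : Decidable (∃ x, p x) :=
  decidable_of_iff' _ exists_iff

instance : Field K4 where
  add_assoc := by decide
  zero_add := by decide
  add_zero := by decide
  add_comm := by decide
  neg_add_cancel := by decide
  mul_assoc := by decide
  one_mul := by decide
  mul_one := by decide
  left_distrib := by decide
  right_distrib := by decide
  zero_mul := by decide
  mul_zero := by decide
  mul_comm := by decide
  exists_pair_ne := ⟨0, 1, by decide⟩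
  mul_inv_cancel := by decide
  inv_zero := by decide
  nsmul := nsmulRec
  zsmul := zsmulRec
  nnqsmul := _
  nnqsmul_def := fun _ _ => rfl
  qsmul := _
  qsmul_def := fun _ _ => rfl

theorem card_eq : Fintype.card K4 = 4 := by decide

theorem two_eq_zero : (2 : K4) = 0 := by decide

instance : CharP K4 2 := CharTwo.of_one_ne_zero_of_two_eq_zero one_ne_zero two_eq_zero

end K4

/-! ## Linear algebra in dimension three -/

/-- The three-dimensional vector space over the field with four elements. -/
abbrev V : Type := Fin 3 → K4

namespace V

theorem eta (v : V) : ![v 0, v 1, v 2] = v := by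
  ext i; fin_cases i <;> rfl

theorem forall_iff {p : V → Prop} : (∀ x, p x) ↔ ∀ a b c, p ![a, b, c] :=
  ⟨fun h _ _ _ => h _, fun h x => eta x ▸ h _ _ _⟩

theorem exists_iff {p : V → Prop} : (∃ x, p x) ↔ ∃ a b c, p ![a, b, c] :=
  ⟨fun ⟨x, h⟩ => ⟨x 0, x 1, x 2, (eta x).symm ▸ h⟩, fun ⟨_, _, _, h⟩ => ⟨_, h⟩⟩

instance decidableForall (p : V → Prop) [DecidablePred p] : Decidable (∀ x, p x) :=
  decidable_of_iff' _ forall_iff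

instance decidableExists (p : V → Prop) [DecidablePred p] : Decidable (∃ x, p x) :=
  decidable_of_iff' _ exists_iff

theorem ext_iff' {x y : V} : x = y ↔ x 0 = y 0 ∧ x 1 = y 1 ∧ x 2 = y 2 :=
  ⟨fun h => h ▸ ⟨rfl, rfl, rfl⟩, fun ⟨h0, h1, h2⟩ => by rw [← eta x, ← eta y, h0, h1, h2]⟩

instance decEq : DecidableEq V := fun _ _ => decidable_of_iff' _ ext_iff'

/-- The standard bilinear form. -/
def dot (a b : V) : K4 := a 0 * b 0 + a 1 * b 1 + a 2 * b 2

/-- The cross product (in characteristic two). -/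
def cross (a b : V) : V :=
  ![a 1 * b 2 + a 2 * b 1, a 2 * b 0 + a 0 * b 2, a 0 * b 1 + a 1 * b 0]

theorem dot_comm (a b : V) : dot a b = dot b a := by unfold dot; ring
theorem dot_add (a b c : V) : dot a (b + c) = dot a b + dot a c := by
  simp only [dot, Pi.add_apply]; ring
theorem add_dot (a b c : V) : dot (a + b) c = dot a c + dot b c := by
  simp only [dot, Pi.add_apply]; ring
theorem dot_smul (r : K4) (a b : V) : dot a (r • b) = r * dot a b := by
  simp only [dot, Pi.smul_apply, smul_eq_mul]; ring
theorem smul_dot (r : K4) (a b : V) : dot (r • a) b = r * dot a b := by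
  simp only [dot, Pi.smul_apply, smul_eq_mul]; ring
theorem dot_zero (a : V) : dot a 0 = 0 := by simp [dot]
theorem zero_dot (a : V) : dot 0 a = 0 := by simp [dot]

end V

open V

/-! ## The projective plane of order four -/

/-- The element of `K4` with the given binary digits. -/
def digit (n : ℕ) : K4 := (n.testBit 0, n.testBit 1)

/-- Normalized representatives of the points of the projective plane of order four. -/
def rep (i : Fin 21) : V :=
  if i.1 < 16 then ![1, digit (i.1 / 4), digit (i.1 % 4)]
  else if i.1 < 20 then ![0, 1, digit (i.1 % 4)] else ![0, 0, 1]

theorem rep_ne_zero : ∀ i, rep i ≠ 0 := by decide +kernel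

theorem eq_of_rep_eq_smul : ∀ i j, ∀ c : K4, rep i = c • rep j → i = j ∧ c = 1 := by
  decide +kernel

theorem rep_injective : Function.Injective rep := fun i j h =>
  (eq_of_rep_eq_smul i j 1 (by rw [h, one_smul])).1

theorem exists_rep : ∀ v : V, v ≠ 0 → ∃ i, ∃ c : K4, c ≠ 0 ∧ c • rep i = v := by
  decide +kernel

theorem exists_dot_eq_one : ∀ i, ∃ v : V, dot v (rep i) = 1 := by decide +kernel

theorem exists_dual : ∀ i j, i ≠ j → ∃ v : V, dot v (rep i) = 1 ∧ dot v (rep j) = 0 := by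
  decide +kernel

theorem card_orthogonal : ∀ i, (Finset.univ.filter fun j => dot (rep j) (rep i) = 0).card = 5 := by
  decide +kernel

/-- The two vectors are independent, so the orthogonal space is a line. -/
theorem card_orthogonal_pair : ∀ i, ∀ z : V, (¬ ∃ c : K4, z = c • rep i) →
    (Finset.univ.filter fun j => dot (rep j) (rep i) = 0 ∧ dot (rep j) z = 0).card = 1 := by
  decide +kernel

/-- The fibres of a surjective homomorphism from 64 elements onto 4 have equal size. -/
theorem card_dot_eq (i : Fin 21) (c : K4) :
    (Finset.univ.filter fun v : V => dot v (rep i) = c).card = 16 := by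
  let g : V →+ K4 :=
    { toFun := fun v => dot v (rep i), map_zero' := zero_dot _, map_add' := fun _ _ => add_dot _ _ _ }
  have hs : Function.Surjective g := fun c => by
    obtain ⟨v, hv⟩ := exists_dot_eq_one i
    exact ⟨c • v, by simp only [g, AddMonoidHom.coe_mk, ZeroHom.coe_mk, smul_dot, hv, mul_one]⟩
  have h : ∀ d, (Finset.univ.filter fun v : V => g v = d).card =
      (Finset.univ.filter fun v : V => g v = c).card := fun d =>
    AddMonoidHom.card_fiber_eq_of_mem_range g (hs d) (hs c)
  have h2 := Finset.card_eq_sum_card_fiberwise (f := g) (s := Finset.univ) (t := Finset.univ)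
    (fun _ _ => Finset.mem_coe.2 (Finset.mem_univ _))
  simp only [h, Finset.sum_const, Finset.card_univ, K4.card_eq, Fintype.card_fun, Fintype.card_fin,
    smul_eq_mul] at h2
  change (Finset.univ.filter fun v : V => g v = c).card = 16
  omega

theorem card_dot_eq_pair (i j : Fin 21) (hij : i ≠ j) (c d : K4) :
    (Finset.univ.filter fun v : V => dot v (rep i) = c ∧ dot v (rep j) = d).card = 4 := by
  let g : V →+ K4 × K4 :=
    { toFun := fun v => (dot v (rep i), dot v (rep j))
      map_zero' := by simp [zero_dot]
      map_add' := fun _ _ => by simp [add_dot] }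
  have hs : Function.Surjective g := fun c => by
    obtain ⟨v, hv, hv'⟩ := exists_dual i j hij
    obtain ⟨w, hw, hw'⟩ := exists_dual j i hij.symm
    refine ⟨c.1 • v + c.2 • w, ?_⟩
    simp [g, smul_dot, add_dot, hv, hv', hw, hw']
  have h : ∀ e, (Finset.univ.filter fun v : V => g v = e).card =
      (Finset.univ.filter fun v : V => g v = (c, d)).card := fun e =>
    AddMonoidHom.card_fiber_eq_of_mem_range g (hs e) (hs (c, d))
  have h2 := Finset.card_eq_sum_card_fiberwise (f := g) (s := Finset.univ) (t := Finset.univ)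
    (fun _ _ => Finset.mem_coe.2 (Finset.mem_univ _))
  simp only [h, Finset.sum_const, Finset.card_univ, K4.card_eq, Fintype.card_fun, Fintype.card_fin,
    Fintype.card_prod, smul_eq_mul] at h2
  have h3 : (Finset.univ.filter fun v : V => dot v (rep i) = c ∧ dot v (rep j) = d) =
    (Finset.univ.filter fun v : V => g v = (c, d)) := by
    ext v; simp [g]
  rw [h3]; omega

open V

/-! ## Chain rings of length two with residue field of order four -/

/-- A presentation of `R` as a chain ring of length two with residue field `K4`: the residue map
`π`, an additive parametrization `ι` of the radical, and the twist `σ` of the radical. -/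
structure ChainData (R : Type*) [Ring R] where
  π : R →+* K4
  ι : K4 →+ R
  σ : K4 →+* K4
  s : K4 → R
  π_s : ∀ a, π (s a) = a
  ι_injective : Function.Injective ι
  π_ι : ∀ b, π (ι b) = 0
  exists_ι : ∀ x, π x = 0 → ∃ b, ι b = x
  mul_ι : ∀ r b, r * ι b = ι (π r * b)
  ι_mul : ∀ r b, ι b * r = ι (b * σ (π r))
  σ_eq : (∀ a, σ a = a) ∨ ∀ a, σ a = a * a

/-- Squaring keeps the leading coordinate 1, so no scalar is needed. -/
theorem exists_rep_eq_square : ∀ i, ∃ j, (fun k => rep i k * rep i k) = rep j := by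
  decide +kernel

namespace ChainData

variable {R : Type*} [Ring R] (D : ChainData R)

theorem σ_σ (a : K4) : D.σ (D.σ a) = a := by
  rcases D.σ_eq with h | h
  · rw [h, h]
  · rw [h, h]; revert a; decide

theorem exists_rep_eq_σ (i : Fin 21) : ∃ j, (fun k => D.σ (rep i k)) = rep j := by
  rcases D.σ_eq with h | h
  · exact ⟨i, funext fun k => h _⟩
  · simp only [h]; exact exists_rep_eq_square i

/-- The permutation of the projective plane induced by `σ`. -/
noncomputable def τ (i : Fin 21) : Fin 21 := (D.exists_rep_eq_σ i).choose

theorem σ_rep (i : Fin 21) (k : Fin 3) : D.σ (rep i k) = rep (D.τ i) k :=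
  congrFun (D.exists_rep_eq_σ i).choose_spec k

theorem τ_τ (i : Fin 21) : D.τ (D.τ i) = i := by
  apply rep_injective
  funext k
  rw [← σ_rep, ← σ_rep, σ_σ]

theorem dot_τ (i j : Fin 21) : dot (rep (D.τ i)) (rep (D.τ j)) = D.σ (dot (rep i) (rep j)) := by
  simp only [dot, map_add, map_mul, σ_rep]

theorem ι_mul_ι (b c : K4) : D.ι b * D.ι c = 0 := by
  rw [D.mul_ι, D.π_ι, zero_mul, map_zero]

theorem ι_one_ne_zero : D.ι 1 ≠ 0 := fun h =>
  one_ne_zero (D.ι_injective (h.trans (map_zero D.ι).symm))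

theorem isUnit_one_add_ι (c : K4) : IsUnit (1 + D.ι c) := by
  refine ⟨⟨1 + D.ι c, 1 - D.ι c, ?_, ?_⟩, rfl⟩ <;>
  · have := D.ι_mul_ι c c
    noncomm_ring
    simp [this]

theorem exists_eq_one_add_ι {r : R} (h : D.π r = 1) : ∃ c, r = 1 + D.ι c := by
  obtain ⟨c, hc⟩ := D.exists_ι (r - 1) (by rw [map_sub, h, map_one, sub_self])
  exact ⟨c, by rw [hc]; abel⟩

/-- Multiplication by a lift of the inverse residue, on either side, gives an element 1 + ι c, which
is a unit because the radical squares to zero. -/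
theorem isUnit_of_π_ne_zero {r : R} (h : D.π r ≠ 0) : IsUnit r := by
  obtain ⟨c, hc⟩ := D.exists_eq_one_add_ι (r := r * D.s (D.π r)⁻¹)
    (by rw [map_mul, D.π_s, mul_inv_cancel₀ h])
  obtain ⟨d, hd⟩ := D.exists_eq_one_add_ι (r := D.s (D.π r)⁻¹ * r)
    (by rw [map_mul, D.π_s, inv_mul_cancel₀ h])
  obtain ⟨u, hu⟩ := D.isUnit_one_add_ι c
  obtain ⟨w, hw⟩ := D.isUnit_one_add_ι d
  rw [isUnit_iff_exists_and_exists]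
  refine ⟨⟨D.s (D.π r)⁻¹ * ↑u⁻¹, ?_⟩, ⟨↑w⁻¹ * D.s (D.π r)⁻¹, ?_⟩⟩
  · rw [← mul_assoc, hc, ← hu, Units.mul_inv]
  · rw [mul_assoc, hd, ← hw, Units.inv_mul]

/-- The vector with residue `x` and radical part `y`. -/
def vec (x y : V) : Fin 3 → R := fun k => D.s (x k) + D.ι (y k)

theorem π_vec (x y : V) (k : Fin 3) : D.π (D.vec x y k) = x k := by
  rw [vec, map_add, D.π_s, D.π_ι, add_zero]

theorem exists_vec {v : Fin 3 → R} {x : V} (h : ∀ k, D.π (v k) = x k) : ∃ y, v = D.vec x y := by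
  choose y hy using fun k => D.exists_ι (v k - D.s (x k)) (by rw [map_sub, D.π_s, h, sub_self])
  exact ⟨y, funext fun k => by rw [vec, hy]; abel⟩

theorem vec_injective (x : V) : Function.Injective (D.vec x) := fun y z h => by
  funext k
  exact D.ι_injective (add_left_cancel (congrFun h k))

theorem vec_mul (x y : V) (c : K4) :
    (fun k => D.vec x y k * (1 + D.ι c)) = D.vec x (y + c • x) := by
  funext k
  simp only [vec, Pi.add_apply, Pi.smul_apply, smul_eq_mul, map_add, mul_add, mul_one, D.mul_ι,
    D.π_s, D.π_ι, add_zero, mul_comm c]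
  abel

/-- Left scalars rescale the equations of lines; moving the radical past a residue applies `σ`,
which is how `τ` enters. -/
theorem mul_vec (i : Fin 21) (y : V) (c : K4) :
    (fun k => (1 + D.ι c) * D.vec (rep i) y k) = D.vec (rep i) (y + c • rep (D.τ i)) := by
  funext k
  simp only [vec, Pi.add_apply, Pi.smul_apply, smul_eq_mul, map_add, add_mul, one_mul, D.ι_mul,
    mul_add, D.π_s, D.π_ι, mul_zero, map_zero, add_zero, D.σ_rep]
  abel

theorem exists_π_ne_zero (i : Fin 21) (y : V) : ∃ k, D.π (D.vec (rep i) y k) ≠ 0 := by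
  by_contra! h
  exact rep_ne_zero i (funext fun k => by rw [← D.π_vec (rep i) y, h, Pi.zero_apply])

/-! ### Points -/

theorem smul_ι_one (y : V) : MulOpposite.op (D.ι 1) • (fun k => D.ι (y k)) = 0 := by
  funext k
  simp [D.ι_mul_ι]

theorem nonempty_basis_span {v : Fin 3 → R} (h : ∃ k, D.π (v k) ≠ 0) :
    Nonempty (Module.Basis (Fin 1) Rᵐᵒᵖ (Submodule.span Rᵐᵒᵖ {v})) := by
  have hli : LinearIndependent Rᵐᵒᵖ (fun _ : Fin 1 => v) := by
    rw [Fintype.linearIndependent_iff]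
    intro g hg i
    obtain ⟨k, hk⟩ := h
    have := congrFun hg k
    simp only [Fin.sum_univ_one, Pi.smul_apply, Pi.zero_apply, MulOpposite.smul_eq_mul_unop] at this
    rw [(D.isUnit_of_π_ne_zero hk).mul_right_eq_zero] at this
    rw [Subsingleton.elim i 0]
    exact MulOpposite.unop_injective this
  have := Nonempty.intro (Module.Basis.span hli)
  rwa [Set.range_const] at this

/-- The points of the plane in coordinates. -/
def pt (a : Fin 21 × V) : Point R :=
  ⟨Submodule.span Rᵐᵒᵖ {D.vec (rep a.1) a.2}, D.nonempty_basis_span (D.exists_π_ne_zero _ _)⟩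

theorem pt_surjective : Function.Surjective D.pt := by
  rintro ⟨M, ⟨b⟩⟩
  set v : Fin 3 → R := (b 0 : Fin 3 → R) with hv
  have hM : M = Submodule.span Rᵐᵒᵖ {v} := by
    have h1 := congrArg (Submodule.map M.subtype) b.span_eq
    rw [Submodule.map_span, Submodule.map_top, Submodule.range_subtype] at h1
    rw [← h1]
    congr 1
    ext z
    simp [hv, Fin.exists_fin_one, eq_comm]
  -- A basis vector with zero residue would be killed by `ι 1`.
  have hne : (fun k => D.π (v k)) ≠ 0 := fun h0 => by
    choose y hy using fun k => D.exists_ι (v k) (congrFun h0 k)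
    have h1 : MulOpposite.op (D.ι 1) • b 0 = 0 := by
      apply Subtype.ext
      rw [Submodule.coe_smul, ← hv, ← funext hy, smul_ι_one]; rfl
    have h2 := congrArg (fun z => b.repr z 0) h1
    simp at h2
    exact D.ι_one_ne_zero h2
  obtain ⟨i, c, hc, hi⟩ := exists_rep _ hne
  have hu : IsUnit (D.s c⁻¹) := D.isUnit_of_π_ne_zero (by rw [D.π_s]; exact inv_ne_zero hc)
  obtain ⟨y, hy⟩ := D.exists_vec (v := fun k => v k * D.s c⁻¹) (x := rep i) fun k => by
    rw [map_mul, D.π_s, ← congrFun hi k, Pi.smul_apply, smul_eq_mul, mul_comm c, mul_assoc,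
      mul_inv_cancel₀ hc, mul_one]
  refine ⟨(i, y), Subtype.ext ?_⟩
  change Submodule.span Rᵐᵒᵖ {D.vec (rep i) y} = M
  rw [hM, ← hy]
  exact Submodule.span_singleton_smul_eq (r := MulOpposite.op (D.s c⁻¹))
    hu.op v

theorem pt_eq_iff (i j : Fin 21) (y z : V) :
    D.pt (i, y) = D.pt (j, z) ↔ i = j ∧ ∃ c : K4, z = y + c • rep i := by
  constructor
  · intro h
    have h1 : D.vec (rep j) z ∈ Submodule.span Rᵐᵒᵖ {D.vec (rep i) y} := by
      have := congrArg Subtype.val h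
      change Submodule.span _ _ = Submodule.span _ _ at this
      rw [this]; exact Submodule.mem_span_singleton_self _
    obtain ⟨r, hr⟩ := Submodule.mem_span_singleton.1 h1
    have hr' : ∀ k, D.vec (rep j) z k = D.vec (rep i) y k * r.unop := fun k =>
      (congrFun hr k).symm
    obtain ⟨hij, hc⟩ := eq_of_rep_eq_smul j i (D.π r.unop) (funext fun k => by
      rw [← D.π_vec (rep j) z, hr', map_mul, D.π_vec, mul_comm]; rfl)
    obtain ⟨c, hc⟩ := D.exists_eq_one_add_ι hc
    subst hij
    refine ⟨rfl, c, D.vec_injective (rep j) ?_⟩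
    rw [← vec_mul, ← hc]; exact funext hr'
  · rintro ⟨rfl, c, rfl⟩
    refine Subtype.ext ?_
    change Submodule.span _ _ = Submodule.span _ _
    rw [← vec_mul]
    exact (Submodule.span_singleton_smul_eq (r := MulOpposite.op (1 + D.ι c))
      (D.isUnit_one_add_ι c).op _).symm

/-! ### Lines -/

/-- The right submodule annihilated by a row vector. -/
def annihilator (φ : Fin 3 → R) : Submodule Rᵐᵒᵖ (Fin 3 → R) where
  carrier := {x | φ ⬝ᵥ x = 0}
  add_mem' {x y} hx hy := by
    rw [Set.mem_ofPred_eq] at *; rw [dotProduct_add, hx, hy, add_zero]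
  zero_mem' := dotProduct_zero φ
  smul_mem' r x hx := by
    rw [Set.mem_ofPred_eq] at *; rw [dotProduct_smul, hx, smul_zero]

theorem mem_annihilator {φ x : Fin 3 → R} : x ∈ annihilator φ ↔ φ ⬝ᵥ x = 0 := Iff.rfl

theorem dotProduct_eq_succAbove (φ x : Fin 3 → R) (k : Fin 3) :
    φ ⬝ᵥ x = φ k * x k + ∑ j, φ (k.succAbove j) * x (k.succAbove j) :=
  Fin.sum_univ_succAbove _ k

/-- The kernel of a row vector with an invertible entry is free of rank two. -/
noncomputable def annihilatorEquiv (φ : Fin 3 → R) (k : Fin 3) (u : Rˣ) (hu : φ k = u) :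
    annihilator φ ≃ₗ[Rᵐᵒᵖ] (Fin 2 → Rᵐᵒᵖ) where
  toFun x j := MulOpposite.op (x.1 (k.succAbove j))
  map_add' x y := rfl
  map_smul' r x := rfl
  invFun z := ⟨Fin.insertNth (α := fun _ => R) k
      (-(↑u⁻¹ * ∑ j, φ (k.succAbove j) * (z j).unop)) fun j => (z j).unop, by
    rw [mem_annihilator, dotProduct_eq_succAbove _ _ k]
    simp only [Fin.insertNth_apply_same, Fin.insertNth_apply_succAbove]
    rw [hu, mul_neg, Units.mul_inv_cancel_left, neg_add_cancel]⟩
  left_inv x := by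
    apply Subtype.ext
    have h := x.2
    rw [mem_annihilator, dotProduct_eq_succAbove _ _ k, hu] at h
    have h' := eq_neg_of_add_eq_zero_left h
    funext l
    induction l using Fin.succAboveCases k with
    | x => 
      simp only [Fin.insertNth_apply_same, MulOpposite.unop_op]
      rw [← mul_neg, ← h', Units.inv_mul_cancel_left]
    | p j => simp only [Fin.insertNth_apply_succAbove, MulOpposite.unop_op]
  right_inv z := by
    funext j
    simp only [Fin.insertNth_apply_succAbove, MulOpposite.op_unop]

theorem nonempty_basis_annihilator {φ : Fin 3 → R} (h : ∃ k, D.π (φ k) ≠ 0) :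
    Nonempty (Module.Basis (Fin 2) Rᵐᵒᵖ (annihilator φ)) := by
  obtain ⟨k, hk⟩ := h
  obtain ⟨u, hu⟩ := D.isUnit_of_π_ne_zero hk
  exact ⟨Module.Basis.ofEquivFun (annihilatorEquiv φ k u hu.symm)⟩

/-- The lines of the plane in coordinates. -/
def ln (a : Fin 21 × V) : Line R :=
  ⟨annihilator (D.vec (rep a.1) a.2), D.nonempty_basis_annihilator (D.exists_π_ne_zero _ _)⟩

theorem annihilator_smul (r : R) (hr : IsUnit r) (φ : Fin 3 → R) :
    annihilator (fun k => r * φ k) = annihilator φ := by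
  ext x
  rw [mem_annihilator, mem_annihilator]
  have : (fun k => r * φ k) ⬝ᵥ x = r * (φ ⬝ᵥ x) := smul_dotProduct r φ x
  rw [this, hr.mul_right_eq_zero]

theorem exists_eq_mul_of_annihilator_le {φ ψ : Fin 3 → R} (h : ∃ k, D.π (φ k) ≠ 0)
    (hle : annihilator φ ≤ annihilator ψ) : ∃ r, ∀ k, ψ k = r * φ k := by
  obtain ⟨k, hk⟩ := h
  obtain ⟨u, hu⟩ := D.isUnit_of_π_ne_zero hk
  refine ⟨ψ k * ↑u⁻¹, fun l => ?_⟩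
  by_cases hlk : l = k
  · rw [hlk, ← hu, mul_assoc, Units.inv_mul, mul_one]
  have h1 : Pi.single l 1 - Pi.single k (↑u⁻¹ * φ l) ∈ annihilator φ := by
    rw [mem_annihilator, dotProduct_sub, dotProduct_single, dotProduct_single, ← hu,
      Units.mul_inv_cancel_left, mul_one, sub_self]
  have h2 := hle h1
  rw [mem_annihilator, dotProduct_sub, dotProduct_single, dotProduct_single, mul_one,
    sub_eq_zero] at h2
  rw [h2, mul_assoc]

theorem ln_eq_iff (i j : Fin 21) (y z : V) :
    D.ln (i, y) = D.ln (j, z) ↔ i = j ∧ ∃ c : K4, z = y + c • rep (D.τ i) := by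
  constructor
  · intro h
    have h1 : annihilator (D.vec (rep i) y) = annihilator (D.vec (rep j) z) :=
      congrArg Subtype.val h
    obtain ⟨r, hr⟩ := D.exists_eq_mul_of_annihilator_le (D.exists_π_ne_zero _ _) h1.le
    obtain ⟨hij, hc⟩ := eq_of_rep_eq_smul j i (D.π r) (funext fun k => by
      rw [← D.π_vec (rep j) z, hr, map_mul, D.π_vec]; rfl)
    obtain ⟨c, hc⟩ := D.exists_eq_one_add_ι hc
    subst hij
    refine ⟨rfl, c, D.vec_injective (rep j) ?_⟩
    rw [← mul_vec, ← hc]; exact funext hr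
  · rintro ⟨rfl, c, rfl⟩
    refine Subtype.ext ?_
    change annihilator _ = annihilator _
    rw [← mul_vec, annihilator_smul _ (D.isUnit_one_add_ι c)]

theorem exists_ι_dotProduct (φ x : Fin 3 → R) (h : dot (fun k => D.π (φ k)) (fun k => D.π (x k)) = 0) :
    ∃ b, D.ι b = φ ⬝ᵥ x :=
  D.exists_ι _ (by
    simp only [dotProduct, Fin.sum_univ_three, map_add, map_mul]; exact h)

theorem vec_dotProduct (x y : V) (v : Fin 3 → R) :
    D.vec x y ⬝ᵥ v = D.vec x 0 ⬝ᵥ v + D.ι (dot y fun k => D.σ (D.π (v k))) := by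
  simp only [dotProduct, Fin.sum_univ_three, vec, Pi.zero_apply, map_zero, add_zero, add_mul,
    D.ι_mul, dot, map_add]
  abel

theorem dotProduct_vec (x y : V) (φ : Fin 3 → R) :
    φ ⬝ᵥ D.vec x y = φ ⬝ᵥ D.vec x 0 + D.ι (dot (fun k => D.π (φ k)) y) := by
  simp only [dotProduct, Fin.sum_univ_three, vec, Pi.zero_apply, map_zero, add_zero, mul_add,
    D.mul_ι, dot, map_add]
  abel

theorem ι_add_eq_zero_iff (b c : K4) : D.ι b + D.ι c = 0 ↔ c = b := by
  rw [← map_add, map_eq_zero_iff _ D.ι_injective, CharTwo.add_eq_zero, eq_comm]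

theorem exists_orthogonal : ∀ i j, ∃ l, dot (rep l) (rep i) = 0 ∧ dot (rep l) (rep j) = 0 := by
  decide +kernel

/-- The residues of a basis are independent, which determines the class `l` of the line; its radical
part `η` solves two linear equations. The inclusion obtained is an equality because both modules are
free of rank two over a finite ring. -/
theorem ln_surjective [Finite R] : Function.Surjective D.ln := by
  rintro ⟨M, ⟨b⟩⟩
  set v : Fin 2 → Fin 3 → R := fun j => (b j : Fin 3 → R) with hv
  -- A relation between residues, multiplied by the radical, becomes a relation between basis
  -- vectors.
  have hind : ∀ α β : K4, (fun k => D.π (v 0 k) * α + D.π (v 1 k) * β) = 0 → α = 0 ∧ β = 0 := by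
    intro α β h0
    have h1 : MulOpposite.op (D.ι α) • b 0 + MulOpposite.op (D.ι β) • b 1 = 0 := by
      apply Subtype.ext
      funext k
      obtain ⟨c, hc⟩ := D.exists_ι (v 0 k * D.s α + v 1 k * D.s β) (by
        simpa [D.π_s] using congrFun h0 k)
      have h2 := congrArg (· * D.ι 1) hc
      simp only [D.ι_mul_ι, add_mul, mul_assoc, D.mul_ι (D.s _), D.π_s, mul_one] at h2
      exact h2.symm
    have h2 := congrArg (fun z => b.repr z 0) h1
    have h3 := congrArg (fun z => b.repr z 1) h1
    simp at h2 h3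
    exact ⟨(map_eq_zero_iff _ D.ι_injective).1 h2, (map_eq_zero_iff _ D.ι_injective).1 h3⟩
  have h0 : (fun k => D.π (v 0 k)) ≠ 0 := fun h =>
    one_ne_zero (hind 1 0 (by funext k; simpa using congrFun h k)).1
  have h1 : (fun k => D.π (v 1 k)) ≠ 0 := fun h =>
    one_ne_zero (hind 0 1 (by funext k; simpa using congrFun h k)).2
  obtain ⟨i, c, hc, hi⟩ := exists_rep _ h0
  obtain ⟨j, d, hd, hj⟩ := exists_rep _ h1
  have hij : i ≠ j := by
    rintro rfl
    refine hd (hind d c (funext fun k => ?_)).1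
    rw [← congrFun hi k, ← congrFun hj k]
    simp only [Pi.smul_apply, smul_eq_mul, Pi.zero_apply]
    rw [← CharTwo.add_self_eq_zero (c * rep i k * d)]; ring
  obtain ⟨l, hl0, hl1⟩ := exists_orthogonal i j
  have hτ : D.τ i ≠ D.τ j := fun h => hij (by rw [← D.τ_τ i, h, D.τ_τ])
  obtain ⟨p, hp, hp'⟩ := exists_dual _ _ hτ
  obtain ⟨q, hq, hq'⟩ := exists_dual _ _ hτ.symm
  obtain ⟨e0, he0⟩ := D.exists_ι_dotProduct (D.vec (rep l) 0) (v 0) (by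
    simp only [π_vec, ← hi, dot_smul]
    exact mul_eq_zero_of_right _ hl0)
  obtain ⟨e1, he1⟩ := D.exists_ι_dotProduct (D.vec (rep l) 0) (v 1) (by
    simp only [π_vec, ← hj, dot_smul]
    exact mul_eq_zero_of_right _ hl1)
  have hσ0 : (fun k => D.σ (D.π (v 0 k))) = D.σ c • rep (D.τ i) := by
    funext k
    rw [← congrFun hi k, Pi.smul_apply, smul_eq_mul, map_mul, σ_rep]; rfl
  have hσ1 : (fun k => D.σ (D.π (v 1 k))) = D.σ d • rep (D.τ j) := by
    funext k
    rw [← congrFun hj k, Pi.smul_apply, smul_eq_mul, map_mul, σ_rep]; rfl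
  have hc' : D.σ c ≠ 0 := (map_ne_zero _).2 hc
  have hd' : D.σ d ≠ 0 := (map_ne_zero _).2 hd
  -- The dual vectors `p`, `q` make the pairings of `η` with the two twisted residues equal to `e0`
  -- and `e1`.
  set η : V := (e0 / D.σ c) • p + (e1 / D.σ d) • q with hη
  have hle : M ≤ annihilator (D.vec (rep l) η) := by
    have hb : ∀ m, (b m : Fin 3 → R) ∈ annihilator (D.vec (rep l) η) := by
      intro m
      rw [mem_annihilator, vec_dotProduct]
      fin_cases m
      · change _ ⬝ᵥ v 0 + D.ι (dot _ fun k => D.σ (D.π (v 0 k))) = 0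
        rw [← he0, hσ0, ι_add_eq_zero_iff, hη, dot_smul, add_dot, smul_dot, smul_dot, hp, hq']
        field_simp
        ring
      · change _ ⬝ᵥ v 1 + D.ι (dot _ fun k => D.σ (D.π (v 1 k))) = 0
        rw [← he1, hσ1, ι_add_eq_zero_iff, hη, dot_smul, add_dot, smul_dot, smul_dot, hp', hq]
        field_simp
        ring
    intro x hx
    have h2 := congrArg Subtype.val (b.sum_repr ⟨x, hx⟩)
    rw [Fin.sum_univ_two] at h2
    change _ = x at h2
    rw [← h2]
    exact add_mem (Submodule.smul_mem _ _ (hb 0)) (Submodule.smul_mem _ _ (hb 1))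
  obtain ⟨b'⟩ := (D.ln (l, η)).2
  refine ⟨(l, η), Subtype.ext (le_antisymm ?_ hle)⟩
  have hsurj := ((Finite.injective_iff_surjective_of_equiv
    (b.equiv b' (Equiv.refl _)).toEquiv).1 (Submodule.inclusion_injective hle))
  intro x hx
  obtain ⟨y, hy⟩ := hsurj ⟨x, hx⟩
  have := congrArg Subtype.val hy
  change y.1 = x at this
  exact this ▸ y.2

/-- The radical part of the pairing of the residues. -/
noncomputable def pairing (j i : Fin 21) : K4 :=
  -- For non-orthogonal residues this is a junk value; `inc_iff` uses it only together with
  -- orthogonality.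
  Function.invFun D.ι (D.vec (rep j) 0 ⬝ᵥ D.vec (rep i) 0)

/-- The product of the two vectors is tested first modulo the radical and then inside it, where it
is affine in `y` and `η` since the radical squares to zero. -/
theorem inc_iff (i j : Fin 21) (y η : V) :
    Inc R (D.pt (i, y)) (D.ln (j, η)) ↔ dot (rep j) (rep i) = 0 ∧
      dot (rep j) y + dot η (rep (D.τ i)) = D.pairing j i := by
  have h1 : Inc R (D.pt (i, y)) (D.ln (j, η)) ↔ D.vec (rep j) η ⬝ᵥ D.vec (rep i) y = 0 := by
    change Submodule.span _ _ ≤ annihilator _ ↔ _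
    rw [Submodule.span_singleton_le_iff_mem, mem_annihilator]
  have hσ : (fun k => D.σ (rep i k)) = rep (D.τ i) := funext fun k => D.σ_rep i k
  have h2 : D.vec (rep j) η ⬝ᵥ D.vec (rep i) y = D.vec (rep j) 0 ⬝ᵥ D.vec (rep i) 0 +
      D.ι (dot (rep j) y + dot η (rep (D.τ i))) := by
    rw [vec_dotProduct, dotProduct_vec, map_add]
    simp only [π_vec, hσ, add_assoc]
  have h3 : D.π (D.vec (rep j) 0 ⬝ᵥ D.vec (rep i) 0) = dot (rep j) (rep i) := by
    simp only [dotProduct, Fin.sum_univ_three, map_add, map_mul, π_vec, dot]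
  rw [h1, h2]
  constructor
  · intro h
    have h4 : dot (rep j) (rep i) = 0 := by
      have := congrArg D.π h
      rwa [map_add, D.π_ι, h3, map_zero, add_zero] at this
    obtain ⟨b, hb⟩ := D.exists_ι _ (h3.trans h4)
    refine ⟨h4, ?_⟩
    rw [pairing, ← hb, Function.leftInverse_invFun D.ι_injective]
    rwa [← hb, ι_add_eq_zero_iff] at h
  · rintro ⟨h4, h5⟩
    obtain ⟨b, hb⟩ := D.exists_ι _ (h3.trans h4)
    rw [pairing, ← hb, Function.leftInverse_invFun D.ι_injective] at h5
    rw [← hb, ι_add_eq_zero_iff, h5]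

end ChainData

/-! ## Coordinates of a projective Hjelmslev plane -/

/-- Coordinates on an incidence structure that make it a projective Hjelmslev plane of level two
over the projective plane of order four. -/
structure Coordinates {P L : Type*} (I : P → L → Prop) where
  pt : Fin 21 × V → P
  ln : Fin 21 × V → L
  τ : Fin 21 → Fin 21
  pairing : Fin 21 → Fin 21 → K4
  τ_τ : ∀ i, τ (τ i) = i
  dot_τ : ∀ i j, dot (rep (τ i)) (rep (τ j)) = 0 ↔ dot (rep i) (rep j) = 0
  pt_surjective : Function.Surjective pt
  ln_surjective : Function.Surjective ln
  pt_eq_iff : ∀ i j y z, pt (i, y) = pt (j, z) ↔ i = j ∧ ∃ c : K4, z = y + c • rep i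
  ln_eq_iff : ∀ i j y z, ln (i, y) = ln (j, z) ↔ i = j ∧ ∃ c : K4, z = y + c • rep (τ i)
  inc_iff : ∀ i j y η, I (pt (i, y)) (ln (j, η)) ↔ dot (rep j) (rep i) = 0 ∧
    dot (rep j) y + dot η (rep (τ i)) = pairing j i

/-- The coordinates of the plane over a chain ring. -/
noncomputable def ChainData.coordinates {R : Type*} [Ring R] [Finite R] (D : ChainData R) :
    Coordinates (Inc R) where
  pt := D.pt
  ln := D.ln
  τ := D.τ
  pairing := D.pairing
  τ_τ := D.τ_τ
  dot_τ i j := by rw [D.dot_τ, map_eq_zero]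
  pt_surjective := D.pt_surjective
  ln_surjective := D.ln_surjective
  pt_eq_iff := D.pt_eq_iff
  ln_eq_iff := D.ln_eq_iff
  inc_iff := D.inc_iff

/-! ### Counting lines through one or two points -/

theorem card_filter_comp {A B : Type*} [Fintype A] [Fintype B] [DecidableEq B] {f : A → B} {n : ℕ}
    (hf : ∀ b, (Finset.univ.filter fun a => f a = b).card = n) (p : B → Prop) [DecidablePred p] :
    (Finset.univ.filter fun a => p (f a)).card = n * (Finset.univ.filter p).card := by
  rw [Finset.card_eq_sum_card_fiberwise (f := f) (t := Finset.univ.filter p)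
    (fun a ha => by simpa using ha), mul_comm, ← smul_eq_mul, ← Finset.sum_const]
  refine Finset.sum_congr rfl fun b hb => ?_
  rw [← hf b, Finset.filter_filter]
  congr 1
  ext a
  simp only [Finset.mem_filter, Finset.mem_univ, true_and, and_iff_right_iff_imp] at hb ⊢
  rintro rfl; exact hb

theorem card_filter_prod {A B : Type*} [Fintype A] [Fintype B] (p : A × B → Prop)
    [DecidablePred p] :
    (Finset.univ.filter p).card = ∑ a, (Finset.univ.filter fun b => p (a, b)).card := by
  simp only [Finset.card_filter, Fintype.sum_prod_type]

theorem card_filter_and_left {A : Type*} [Fintype A] (q : Prop) [Decidable q] (p : A → Prop)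
    [DecidablePred p] : (Finset.univ.filter fun a => q ∧ p a).card =
      if q then (Finset.univ.filter p).card else 0 := by
  split_ifs with h <;> simp [h]

namespace Coordinates

variable {P L : Type*} {I : P → L → Prop} (C : Coordinates I)

/-- The coordinates of the dual plane. -/
def dual : Coordinates (fun l p => I p l) where
  -- Relabelling by `τ` turns the ambiguity `rep (τ i)` of lines into the ambiguity `rep i` required
  -- of points.
  pt a := C.ln (C.τ a.1, a.2)
  ln a := C.pt (C.τ a.1, a.2)
  τ := C.τ
  pairing j i := C.pairing (C.τ i) (C.τ j)
  τ_τ := C.τ_τ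
  dot_τ := C.dot_τ
  pt_surjective l := by
    obtain ⟨⟨i, y⟩, rfl⟩ := C.ln_surjective l
    exact ⟨(C.τ i, y), by simp only [C.τ_τ]⟩
  ln_surjective l := by
    obtain ⟨⟨i, y⟩, rfl⟩ := C.pt_surjective l
    exact ⟨(C.τ i, y), by simp only [C.τ_τ]⟩
  pt_eq_iff i j y z := by
    simp only [C.ln_eq_iff, C.τ_τ, Function.Injective.eq_iff (Function.LeftInverse.injective C.τ_τ)]
  ln_eq_iff i j y z := by
    simp only [C.pt_eq_iff, Function.Injective.eq_iff (Function.LeftInverse.injective C.τ_τ)]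
  inc_iff i j y η := by
    simp only [C.inc_iff, C.τ_τ, C.dot_τ]
    rw [dot_comm (rep i), dot_comm y, dot_comm (rep (C.τ i)), add_comm]

theorem card_fiber_pt [DecidableEq P] (x : P) : (Finset.univ.filter fun a => C.pt a = x).card = 4 := by
  obtain ⟨⟨i, y⟩, rfl⟩ := C.pt_surjective x
  have : (Finset.univ.filter fun a => C.pt a = C.pt (i, y)) =
      Finset.univ.image fun c : K4 => (i, y + c • rep i) := by
    ext ⟨j, z⟩
    simp only [Finset.mem_filter, Finset.mem_univ, true_and, Finset.mem_image, Prod.mk.injEq]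
    rw [eq_comm, C.pt_eq_iff]
    constructor
    · rintro ⟨rfl, c, rfl⟩; exact ⟨c, rfl, rfl⟩
    · rintro ⟨c, rfl, rfl⟩; exact ⟨rfl, c, rfl⟩
  rw [this, Finset.card_image_of_injective, Finset.card_univ, K4.card_eq]
  intro c d h
  exact smul_left_injective K4 (rep_ne_zero i) (add_left_cancel (Prod.mk.inj h).2)

theorem card_fiber_ln [DecidableEq L] (l : L) : (Finset.univ.filter fun a => C.ln a = l).card = 4 := by
  rw [← C.dual.card_fiber_pt l]
  refine Finset.card_bij' (fun a _ => (C.τ a.1, a.2)) (fun a _ => (C.τ a.1, a.2))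
    (fun a ha => ?_) (fun a ha => ?_) (fun a _ => by simp only [C.τ_τ])
    (fun a _ => by simp only [C.τ_τ]) <;>
  · rw [Finset.mem_filter] at ha ⊢
    exact ⟨Finset.mem_univ _, by simpa only [dual, C.τ_τ] using ha.2⟩

/-- The neighbour class of a point. -/
noncomputable def cl (x : P) : Fin 21 := (Function.surjInv C.pt_surjective x).1

theorem cl_pt (a : Fin 21 × V) : C.cl (C.pt a) = a.1 := by
  have h := Function.surjInv_eq C.pt_surjective (C.pt a)
  exact ((C.pt_eq_iff _ _ _ _).1 h).1

theorem card_lines [Fintype L] (C : Coordinates I) : Fintype.card L = 336 := by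
  classical
  have h := card_filter_comp C.card_fiber_ln fun _ => True
  simp [K4.card_eq] at h
  omega

variable [Fintype L] [DecidableEq P] [∀ x l, Decidable (I x l)]

/-- Every line has 4 coordinate pairs (j, η). Equal points allow 5 values of j with 16 of η;
neighbours impose orthogonality to y + y' as well, leaving 1 and 16; points of different classes
leave 1 and 4. -/
theorem card_join (x x' : P) : (Finset.univ.filter fun l => I x l ∧ I x' l).card =
    if x = x' then 20 else if C.cl x = C.cl x' then 4 else 1 := by
  obtain ⟨⟨i, y⟩, rfl⟩ := C.pt_surjective x
  obtain ⟨⟨i', y'⟩, rfl⟩ := C.pt_surjective x'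
  classical
  have h4 := card_filter_comp C.card_fiber_ln fun l => I (C.pt (i, y)) l ∧ I (C.pt (i', y')) l
  rw [card_filter_prod] at h4
  have hinc : ∀ (i j : Fin 21) (y η : V), I (C.pt (i, y)) (C.ln (j, η)) ↔
      dot (rep j) (rep i) = 0 ∧ dot η (rep (C.τ i)) = C.pairing j i + dot (rep j) y := by
    intro i j y η
    rw [C.inc_iff]
    refine and_congr_right fun _ => ⟨fun h => ?_, fun h => ?_⟩
    · linear_combination h - dot (rep j) y * K4.two_eq_zero
    · linear_combination h + dot (rep j) y * K4.two_eq_zero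
  rw [cl_pt, cl_pt]
  split_ifs with h1 h2
  · simp only [← h1, and_self, hinc, card_filter_and_left, card_dot_eq] at h4
    rw [← Finset.sum_filter, Finset.sum_const, card_orthogonal, smul_eq_mul] at h4
    simp only [← h1, and_self]
    omega
  · simp only at h2
    subst h2
    have hz : ¬ ∃ c : K4, y + y' = c • rep i := by
      rintro ⟨c, hc⟩
      exact h1 ((C.pt_eq_iff _ _ _ _).2 ⟨rfl, c, by rw [← hc, ← add_assoc, CharTwo.add_self_eq_zero,
        zero_add]⟩)
    have h5 : ∀ j η, (I (C.pt (i, y)) (C.ln (j, η)) ∧ I (C.pt (i, y')) (C.ln (j, η))) ↔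
        (dot (rep j) (rep i) = 0 ∧ dot (rep j) (y + y') = 0) ∧
          dot η (rep (C.τ i)) = C.pairing j i + dot (rep j) y := by
      intro j η
      rw [hinc, hinc, dot_add, CharTwo.add_eq_zero]
      constructor
      · rintro ⟨⟨h, h'⟩, -, h''⟩
        exact ⟨⟨h, add_left_cancel (h'.symm.trans h'')⟩, h'⟩
      · rintro ⟨⟨h, h'⟩, h''⟩
        exact ⟨⟨h, h''⟩, h, by rw [h'', h']⟩
    simp only [h5, card_filter_and_left, card_dot_eq] at h4
    rw [← Finset.sum_filter, Finset.sum_const, card_orthogonal_pair i _ hz, smul_eq_mul] at h4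
    omega
  · simp only at h2
    have hz : ¬ ∃ c : K4, rep i' = c • rep i := by
      rintro ⟨c, hc⟩
      exact h2 (eq_of_rep_eq_smul _ _ _ hc).1.symm
    have h5 : ∀ j η, (I (C.pt (i, y)) (C.ln (j, η)) ∧ I (C.pt (i', y')) (C.ln (j, η))) ↔
        (dot (rep j) (rep i) = 0 ∧ dot (rep j) (rep i') = 0) ∧
          dot η (rep (C.τ i)) = C.pairing j i + dot (rep j) y ∧
          dot η (rep (C.τ i')) = C.pairing j i' + dot (rep j) y' := by
      intro j η
      rw [hinc, hinc]
      exact ⟨fun ⟨⟨h, h'⟩, h'', h3⟩ => ⟨⟨h, h''⟩, h', h3⟩, fun ⟨⟨h, h''⟩, h', h3⟩ => ⟨⟨h, h'⟩, h'', h3⟩⟩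
    have hτ : C.τ i ≠ C.τ i' := fun h => h2 (by rw [← C.τ_τ i, h, C.τ_τ])
    simp only [h5, card_filter_and_left, card_dot_eq_pair _ _ hτ] at h4
    rw [← Finset.sum_filter, Finset.sum_const, card_orthogonal_pair i _ hz, smul_eq_mul] at h4
    omega

theorem card_through (C : Coordinates I) (x : P) : (Finset.univ.filter fun l => I x l).card = 20 := by
  simpa using C.card_join x x

end Coordinates

/-! ### Line multiplicities and the counting inequality for arcs -/

theorem lineMult_eq_sum {P L : Type*} [Fintype P] (I : P → L → Prop) [∀ x l, Decidable (I x l)]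
    (K : P → ℕ) (l : L) : lineMult I K l = ∑ x with I x l, K x := by
  rw [lineMult, finsum_eq_sum_of_fintype, Finset.sum_filter]
  exact Finset.sum_congr rfl fun x _ => finsum_eq_if

theorem lineMult_eq_zero_iff {P L : Type*} [Finite P] (I : P → L → Prop) (K : P → ℕ) (l : L) :
    lineMult I K l = 0 ↔ ∀ x, I x l → K x = 0 := by
  classical
  have := Fintype.ofFinite P
  simp [lineMult_eq_sum]

/-- Numbers that are all equal to `0` or `n` have the sum `n` times the number of nonzero ones. -/
theorem sum_of_eq_zero_or {A : Type*} (s : Finset A) (f : A → ℕ) {n : ℕ}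
    (h : ∀ a ∈ s, f a = 0 ∨ f a = n) :
    ∑ a ∈ s, f a + n * (s.filter fun a => f a = 0).card = n * s.card := by
  rw [Finset.card_filter, Finset.mul_sum, ← Finset.sum_add_distrib, mul_comm, ← smul_eq_mul,
    ← Finset.sum_const]
  refine Finset.sum_congr rfl fun a ha => ?_
  split_ifs with h0
  · simp [h0]
  · simp [(h a ha).resolve_left h0]

theorem eq_of_sum_eq_mul {A : Type*} (s : Finset A) (f : A → ℕ) {n : ℕ} (h : ∀ a ∈ s, f a ≤ n)
    (hs : ∑ a ∈ s, f a = n * s.card) : ∀ a ∈ s, f a = n := by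
  refine (Finset.sum_eq_sum_iff_of_le h).1 ?_
  rw [hs, Finset.sum_const, smul_eq_mul, mul_comm]

namespace Coordinates

variable {P L : Type*} {I : P → L → Prop} (C : Coordinates I) [Fintype P]

/-- The multiplicity of a neighbour class of points. -/
noncomputable def classMult (K : P → ℕ) (i : Fin 21) : ℕ := ∑ x with C.cl x = i, K x

theorem sum_classMult (K : P → ℕ) : ∑ i, C.classMult K i = ∑ x, K x :=
  Finset.sum_fiberwise _ _ _

theorem le_classMult (K : P → ℕ) (x : P) : K x ≤ C.classMult K (C.cl x) :=
  Finset.single_le_sum (f := K) (fun _ _ => Nat.zero_le _) (by simp)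

theorem _root_.Hjelmslev.IsArc.sum_eq {K : P → ℕ} {k n : ℕ} (hK : IsArc I K k n) :
    ∑ x, K x = k := by rw [← hK.size_eq, finsum_eq_sum_of_fintype]

/-- A class of positive multiplicity contains a point of `K`, so the bound holds for all 21 classes
and the total leaves no slack. -/
theorem classMult_eq_of_le {K : P → ℕ} {k u : ℕ} (hk : ∑ x, K x = k) (hu : u * 21 ≤ k)
    (h : ∀ x, K x ≠ 0 → C.classMult K (C.cl x) ≤ u) :
    k = u * 21 ∧ ∀ i, C.classMult K i = u := by
  have hle : ∀ i, C.classMult K i ≤ u := fun i => by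
    by_contra! hi
    obtain ⟨x, hx, hx0⟩ := Finset.exists_ne_zero_of_sum_ne_zero (Nat.ne_zero_of_lt hi)
    simp only [Finset.mem_filter, Finset.mem_univ, true_and] at hx
    have := h x hx0
    rw [hx] at this; omega
  have hsum : ∑ i, C.classMult K i ≤ u * 21 := by
    simpa [mul_comm] using Finset.sum_le_card_nsmul Finset.univ _ u fun i _ => hle i
  rw [sum_classMult, hk] at hsum
  refine ⟨le_antisymm hsum hu, fun i => ?_⟩
  refine eq_of_sum_eq_mul Finset.univ _ (fun i _ => hle i) ?_ i (Finset.mem_univ i)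
  rw [sum_classMult, hk, Finset.card_univ, Fintype.card_fin]; omega

/-- One point in each neighbour class, no three of them collinear, form a hyperoval. -/
theorem isArc_of_no_three_collinear (C : Coordinates I) (f : Fin 21 → V)
    (hf : ∀ i j k, i ≠ j → i ≠ k → j ≠ k → ∀ l,
      ¬ (I (C.pt (i, f i)) l ∧ I (C.pt (j, f j)) l ∧ I (C.pt (k, f k)) l)) :
    ∃ K : P → ℕ, IsArc I K 21 2 := by
  classical
  have hinj : Function.Injective fun i => C.pt (i, f i) := fun i j h =>
    ((C.pt_eq_iff _ _ _ _).1 h).1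
  refine ⟨fun x => if x ∈ Finset.univ.image (fun i => C.pt (i, f i)) then 1 else 0, ?_, fun l => ?_⟩
  · rw [finsum_eq_sum_of_fintype, Finset.sum_boole, Nat.cast_id, Finset.filter_univ_mem,
      Finset.card_image_of_injective _ hinj, Finset.card_univ, Fintype.card_fin]
  · rw [lineMult_eq_sum, Finset.sum_boole, Nat.cast_id]
    by_contra! h
    obtain ⟨a, ha, b, hb, c, hc, hab, hac, hbc⟩ := Finset.two_lt_card.1 h
    simp only [Finset.mem_filter, Finset.mem_univ, Finset.mem_image, true_and] at ha hb hc
    obtain ⟨ha, i, rfl⟩ := ha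
    obtain ⟨hb, j, rfl⟩ := hb
    obtain ⟨hc, k, rfl⟩ := hc
    exact hf i j k (fun h => hab (by rw [h])) (fun h => hac (by rw [h])) (fun h => hbc (by rw [h]))
      l ⟨ha, hb, hc⟩

theorem lineMult_dual_ite {P L : Type*} {I : P → L → Prop} [Fintype L] [∀ x l, Decidable (I x l)] (K : P → ℕ) (x : P) :
    lineMult (fun l p => I p l) (fun l => if lineMult I K l = 0 then 1 else 0) x =
      (Finset.univ.filter fun l => I x l ∧ lineMult I K l = 0).card := by
  classical
  rw [lineMult_eq_sum, Finset.sum_boole, Finset.filter_filter, Nat.cast_id]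

variable [Fintype L]

/-- The sum of the multiplicities of the lines through a point. -/
theorem sum_lineMult_through [∀ x l, Decidable (I x l)] (K : P → ℕ) (x : P) :
    ∑ l with I x l, lineMult I K l = ∑ x, K x + 3 * C.classMult K (C.cl x) + 16 * K x := by
  classical
  simp only [lineMult_eq_sum]
  -- A point y counts once for each line joining it to x: 20 = 1 + 3 + 16 times if y = x, 4 = 1 + 3
  -- times if it is another neighbour, and once otherwise.
  rw [Finset.sum_comm' (t' := Finset.univ) (s' := fun y => Finset.univ.filter fun l => I x l ∧ I y l)
    (by simp)]
  simp only [Finset.sum_const, card_join C, smul_eq_mul, classMult]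
  rw [Finset.mul_sum, Finset.sum_filter]
  have hx : 16 * K x = ∑ y, if x = y then 16 * K y else 0 := by simp
  rw [hx, ← Finset.sum_add_distrib, ← Finset.sum_add_distrib]
  refine Finset.sum_congr rfl fun y _ => ?_
  by_cases h1 : x = y
  · subst h1; simp; ring
  · by_cases h2 : C.cl x = C.cl y
    · simp only [h1, h2, if_true, if_false]; ring
    · simp [h1, h2, Ne.symm h2]

theorem sum_lineMult (C : Coordinates I) (K : P → ℕ) : ∑ l, lineMult I K l = 20 * ∑ x, K x := by
  classical
  simp only [lineMult_eq_sum]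
  rw [Finset.sum_comm' (t' := Finset.univ) (s' := fun y => Finset.univ.filter fun l => I y l)
    (by simp)]
  simp only [Finset.sum_const, card_through C, smul_eq_mul, Finset.mul_sum]

theorem _root_.Hjelmslev.IsArc.le {K : P → ℕ} {k n : ℕ} (hK : IsArc I K k n) (x : P) :
    k + 3 * C.classMult K (C.cl x) + 16 * K x ≤ n * 20 := by
  classical
  rw [← hK.sum_eq, ← C.sum_lineMult_through K x, ← C.card_through x, mul_comm, ← smul_eq_mul]
  exact Finset.sum_le_card_nsmul _ _ _ fun l _ => hK.lineMult_le l

/-- If the counting bound is attained at every point of an arc, then every line is either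
empty or full. -/
theorem _root_.Hjelmslev.IsArc.eq_zero_or {K : P → ℕ} {k n : ℕ} (hK : IsArc I K k n)
    (h : ∀ x, K x ≠ 0 → k + 3 * C.classMult K (C.cl x) + 16 * K x = n * 20) (l : L) :
    lineMult I K l = 0 ∨ lineMult I K l = n := by
  classical
  refine or_iff_not_imp_left.2 fun hl => ?_
  rw [lineMult_eq_zero_iff] at hl
  push Not at hl
  obtain ⟨x, hxl, hx⟩ := hl
  refine eq_of_sum_eq_mul (Finset.univ.filter fun l => I x l) _ (fun l _ => hK.lineMult_le l) ?_ l
    (by simpa using hxl)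
  rw [C.sum_lineMult_through, hK.sum_eq, h x hx, C.card_through]

/-- The number of empty lines through a point. -/
theorem card_empty_through [∀ x l, Decidable (I x l)] {K : P → ℕ} {k n : ℕ} (hK : IsArc I K k n)
    (h : ∀ l, lineMult I K l = 0 ∨ lineMult I K l = n) (x : P) :
    k + 3 * C.classMult K (C.cl x) + 16 * K x +
      n * (Finset.univ.filter fun l => I x l ∧ lineMult I K l = 0).card = n * 20 := by
  classical
  have := sum_of_eq_zero_or (Finset.univ.filter fun l => I x l) (lineMult I K) fun l _ => h l
  rwa [C.sum_lineMult_through, hK.sum_eq, C.card_through, Finset.filter_filter] at this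

theorem card_empty (C : Coordinates I) {K : P → ℕ} {k n : ℕ} (hK : IsArc I K k n)
    (h : ∀ l, lineMult I K l = 0 ∨ lineMult I K l = n) :
    20 * k + n * (Finset.univ.filter fun l => lineMult I K l = 0).card = n * 336 := by
  have := sum_of_eq_zero_or Finset.univ (lineMult I K) fun l _ => h l
  rwa [C.sum_lineMult, hK.sum_eq, Finset.card_univ, C.card_lines] at this

/-! ### The correspondence between (126, 8)-arcs and dual hyperovals -/

/-- In 126 + 3u + 16K(x) ≤ 160 with u ≥ K(x), the value K(x) = 2 would already give 164, while K(x)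
= 1 leaves u ≤ 6; and 21 · 6 = 126. -/
theorem arc_eight {K : P → ℕ} {k : ℕ} (hk : 126 ≤ k) (hK : IsArc I K k 8) :
    k = 126 ∧ IsProjective K ∧ ∀ i, C.classMult K i = 6 := by
  have h1 : ∀ x, K x = 0 ∨ K x = 1 := fun x => by
    have := hK.le C x
    have := C.le_classMult K x
    omega
  obtain ⟨h2, h3⟩ := C.classMult_eq_of_le (u := 6) hK.sum_eq (by omega) fun x hx => by
    have := hK.le C x
    omega
  exact ⟨by omega, h1, h3⟩

theorem arc_eight_lines (C : Coordinates I) {K : P → ℕ} (hK : IsArc I K 126 8) (l : L) :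
    lineMult I K l = 0 ∨ lineMult I K l = 8 := by
  obtain ⟨-, h1, h2⟩ := C.arc_eight le_rfl hK
  refine hK.eq_zero_or C (fun x hx => ?_) l
  rw [h2, (h1 x).resolve_left hx]

/-- The number e of empty lines satisfies 20 · 126 + 8e = 8 · 336, so e = 21; through a point, 126 +
18 + 16K(x) + 8e = 160, so e is 2 or 0. -/
theorem isArc_emptyLines (C : Coordinates I) {K : P → ℕ} (hK : IsArc I K 126 8) :
    IsArc (fun l p => I p l) (fun l => if lineMult I K l = 0 then 1 else 0) 21 2 := by
  classical
  obtain ⟨-, -, h2⟩ := C.arc_eight le_rfl hK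
  refine ⟨?_, fun x => ?_⟩
  · rw [finsum_eq_sum_of_fintype, Finset.sum_boole, Nat.cast_id]
    have := C.card_empty hK (C.arc_eight_lines hK)
    omega
  · rw [lineMult_dual_ite]
    have := C.card_empty_through hK (C.arc_eight_lines hK) x
    rw [h2] at this
    omega

/-- Here the inequality is 21 + 3u + 16K(x) ≤ 40. -/
theorem hyperoval {K : P → ℕ} (hK : IsArc I K 21 2) :
    IsProjective K ∧ ∀ i, C.classMult K i = 1 := by
  have h1 : ∀ x, K x = 0 ∨ K x = 1 := fun x => by
    have := hK.le C x
    have := C.le_classMult K x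
    omega
  exact ⟨h1, (C.classMult_eq_of_le (u := 1) hK.sum_eq (by omega) fun x hx => by
    have := hK.le C x
    have := C.le_classMult K x
    omega).2⟩

/-- The empty lines of a hyperoval form an arc of size 126 in the dual plane. -/
theorem isArc_of_hyperoval (C : Coordinates I) {K : P → ℕ} (hK : IsArc I K 21 2) :
    IsArc (fun l p => I p l) (fun l => if lineMult I K l = 0 then 1 else 0) 126 8 := by
  classical
  obtain ⟨h1, h2⟩ := C.hyperoval hK
  have h3 := hK.eq_zero_or C fun x hx => by rw [h2, (h1 x).resolve_left hx]
  refine ⟨?_, fun x => ?_⟩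
  · rw [finsum_eq_sum_of_fintype, Finset.sum_boole, Nat.cast_id]
    -- 20 · 21 + 2e = 2 · 336 gives e = 126; through a point, 21 + 3 + 16K(x) + 2e = 40 gives 8 or
    -- 0.
    have := C.card_empty hK h3
    omega
  · rw [lineMult_dual_ite]
    have := C.card_empty_through hK h3 x
    rw [h2] at this
    omega

/-- A hyperoval consists of one point in each neighbour class, no three of them collinear. -/
theorem exists_of_hyperoval {K : P → ℕ} (hK : IsArc I K 21 2) : ∃ f : Fin 21 → V,
    ∀ i j k, i ≠ j → i ≠ k → j ≠ k → ∀ l,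
      ¬ (I (C.pt (i, f i)) l ∧ I (C.pt (j, f j)) l ∧ I (C.pt (k, f k)) l) := by
  classical
  have h : ∀ i, ∃ y, K (C.pt (i, y)) ≠ 0 := fun i => by
    obtain ⟨x, hx, hx0⟩ := Finset.exists_ne_zero_of_sum_ne_zero
      (show C.classMult K i ≠ 0 by rw [(C.hyperoval hK).2]; exact one_ne_zero)
    obtain ⟨⟨j, y⟩, rfl⟩ := C.pt_surjective x
    simp only [Finset.mem_filter, Finset.mem_univ, true_and, cl_pt] at hx
    subst hx
    exact ⟨y, hx0⟩
  choose f hf using h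
  refine ⟨f, fun i j k hij hik hjk l ⟨h1, h2, h3⟩ => ?_⟩
  have hne : ∀ {i j}, i ≠ j → C.pt (i, f i) ≠ C.pt (j, f j) := fun hij h =>
    hij ((C.pt_eq_iff _ _ _ _).1 h).1
  have h4 := hK.lineMult_le l
  rw [lineMult_eq_sum] at h4
  have h5 := Finset.sum_le_sum_of_subset (f := K)
    (show {C.pt (i, f i), C.pt (j, f j), C.pt (k, f k)} ⊆ Finset.univ.filter fun x => I x l by
      intro x hx
      simp only [Finset.mem_insert, Finset.mem_singleton] at hx
      rcases hx with rfl | rfl | rfl <;> simpa)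
  rw [Finset.sum_insert (by simp [hne hij, hne hik]), Finset.sum_insert (by simp [hne hjk]),
    Finset.sum_singleton] at h5
  have := Nat.pos_of_ne_zero (hf i)
  have := Nat.pos_of_ne_zero (hf j)
  have := Nat.pos_of_ne_zero (hf k)
  omega

end Coordinates

/-! ## Consequences for the planes over chain rings -/

namespace ChainData

variable {R : Type*} [Ring R] [Finite R]

theorem arcsAreDualHyperovals (D : ChainData R) : ArcsAreDualHyperovals R := by
  classical
  have := Fintype.ofFinite (Point R)
  have := Fintype.ofFinite (Line R)
  intro K hK
  refine ⟨(D.coordinates.arc_eight le_rfl hK).2.1, D.coordinates.arc_eight_lines hK, ?_⟩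
  have h := D.coordinates.isArc_emptyLines hK
  have he : emptyLines R K = fun l => if lineMult (Inc R) K l = 0 then 1 else 0 := by
    funext l
    simp [emptyLines, Set.indicator_apply]
  rw [he]
  exact h

theorem m_eight_le (D : ChainData R) : m 8 R ≤ 126 := by
  have := Fintype.ofFinite (Point R)
  have := Fintype.ofFinite (Line R)
  obtain ⟨K, -, hK⟩ := (isGreatest_maxArcSize (Inc R) 8).1
  by_contra! h
  exact h.ne' (D.coordinates.arc_eight h.le hK).1

theorem m_eight_eq_of_isDualHyperoval (D : ChainData R) {H : Line R → ℕ} (hH : IsDualHyperoval R H) :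
    m 8 R = 126 := by
  classical
  have := Fintype.ofFinite (Point R)
  have := Fintype.ofFinite (Line R)
  refine le_antisymm D.m_eight_le ((isGreatest_maxArcSize (Inc R) 8).2 ⟨_, fun x => ?_,
    D.coordinates.dual.isArc_of_hyperoval hH⟩)
  split_ifs
  exacts [Or.inr rfl, Or.inl rfl]

theorem m_eight_le_of_not_exists (D : ChainData R) (h : ¬ ∃ H, IsDualHyperoval R H) : m 8 R ≤ 125 := by
  obtain ⟨K, -, hK⟩ := (isGreatest_maxArcSize (Inc R) 8).1
  have h1 := D.m_eight_le
  by_contra! h2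
  have h3 : maxArcSize (Inc R) 8 = 126 := le_antisymm h1 h2
  rw [h3] at hK
  exact h ⟨_, (D.arcsAreDualHyperovals K hK).2.2⟩

end ChainData

/-! ## Lifts of the dual projective plane without three concurrent lines -/

namespace K4

theorem ω_mul_ω : ω * ω = ω + 1 := by decide

theorem sum_eq (f : K4 → K4) : ∑ x, f x = f 0 + f 1 + f ω + f (ω + 1) := by
  have h : (Finset.univ : Finset K4) = {0, 1, ω, ω + 1} := by decide
  rw [h, Finset.sum_insert (by decide), Finset.sum_insert (by decide),
    Finset.sum_insert (by decide), Finset.sum_singleton]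
  ring

theorem pow_three : ∀ x : K4, x ≠ 0 → x ^ 3 = 1 := by decide

theorem sum_const_eq_zero (c : K4) : ∑ _x : K4, c = 0 := by
  rw [sum_eq]; have := two_eq_zero; grind

/-- A homogeneous function on a plane that is nowhere additive is determined by its values
at three points. -/
theorem values_of_nonadditive : ∀ a b c : K4, a + b + c ≠ 0 → ∀ d, a + ω * b + d ≠ 0 →
    c + d + (ω + 1) * b ≠ 0 → ∀ e, a + (ω + 1) * b + e ≠ 0 → c + e + ω * b ≠ 0 →
    d + e + b ≠ 0 → c + ω * d + (ω + 1) * e ≠ 0 →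
    d = a + ω * b + ω ^ 2 * (a + b + c) ∧ e = a + (ω + 1) * b + (ω + 1) ^ 2 * (a + b + c) := by
  decide +kernel

/-- Squaring is additive, so the inner double sum is p q² for every a, and four equal terms cancel.
-/
theorem sum_mul_sq_eq_zero {f g : K4 → K4 → K4} {p q : K4} (hf : ∀ a, ∑ b, f a b = p)
    (hg : ∀ a, ∑ b, g a b = q) : ∑ a, ∑ b, ∑ c, f a b * g a c ^ 2 = 0 := by
  have h : ∀ a, ∑ b, ∑ c, f a b * g a c ^ 2 = p * q ^ 2 := fun a => by
    simp only [← Finset.mul_sum]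
    rw [← Finset.sum_mul, hf, ← CharTwo.sum_sq, hg]
  simp only [h, sum_const_eq_zero]

theorem sum_comm_right (f : K4 → K4 → K4 → K4) :
    ∑ a, ∑ b, ∑ c, f a b c = ∑ a, ∑ c, ∑ b, f a b c :=
  Finset.sum_congr rfl fun _ _ => Finset.sum_comm

/-- The cubes of a sum of functions of two variables with constant marginals add up to zero. -/
theorem sum_cube_eq_zero {f g h : K4 → K4 → K4} {f1 f2 g1 g2 h1 h2 : K4}
    (hf1 : ∀ b, ∑ a, f a b = f1) (hf2 : ∀ a, ∑ b, f a b = f2)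
    (hg1 : ∀ c, ∑ a, g a c = g1) (hg2 : ∀ a, ∑ c, g a c = g2)
    (hh1 : ∀ c, ∑ b, h b c = h1) (hh2 : ∀ b, ∑ c, h b c = h2) :
    ∑ a, ∑ b, ∑ c, (f a b + g a c + h b c) ^ 3 = 0 := by
  -- Since x³ = x · x² and squaring is additive, the cube is a sum of nine products; the three pure
  -- ones do not depend on one of the variables.
  have e : ∀ a b c, (f a b + g a c + h b c) ^ 3 =
      f a b * f a b ^ 2 + g a c * g a c ^ 2 + h b c * h b c ^ 2 + f a b * g a c ^ 2 +
      g a c * f a b ^ 2 + f a b * h b c ^ 2 + h b c * f a b ^ 2 + g a c * h b c ^ 2 +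
      h b c * g a c ^ 2 := fun a b c => by
    have := two_eq_zero; grind
  simp only [e, Finset.sum_add_distrib]
  have t1 : ∑ a, ∑ b, ∑ _c : K4, f a b * f a b ^ 2 = 0 := by simp only [sum_const_eq_zero]
  have t2 : ∑ a, ∑ _b : K4, ∑ c, g a c * g a c ^ 2 = 0 := by simp only [sum_const_eq_zero]
  have t3 : ∑ _a : K4, ∑ b, ∑ c, h b c * h b c ^ 2 = 0 := by simp only [sum_const_eq_zero]
  have t4 : ∑ a, ∑ b, ∑ c, f a b * g a c ^ 2 = 0 := sum_mul_sq_eq_zero hf2 hg2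
  have t5 : ∑ a, ∑ b, ∑ c, g a c * f a b ^ 2 = 0 := by
    rw [sum_comm_right]; exact sum_mul_sq_eq_zero hg2 hf2
  have t6 : ∑ a, ∑ b, ∑ c, f a b * h b c ^ 2 = 0 := by
    rw [Finset.sum_comm]; exact sum_mul_sq_eq_zero (f := fun b a => f a b) hf1 hh2
  have t7 : ∑ a, ∑ b, ∑ c, h b c * f a b ^ 2 = 0 := by
    rw [Finset.sum_comm, sum_comm_right]; exact sum_mul_sq_eq_zero (g := fun b a => f a b) hh2 hf1
  have t8 : ∑ a, ∑ b, ∑ c, g a c * h b c ^ 2 = 0 := by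
    rw [sum_comm_right, Finset.sum_comm]
    exact sum_mul_sq_eq_zero (f := fun c a => g a c) (g := fun c b => h b c) hg1 hh1
  have t9 : ∑ a, ∑ b, ∑ c, h b c * g a c ^ 2 = 0 := by
    rw [sum_comm_right, Finset.sum_comm, sum_comm_right]
    exact sum_mul_sq_eq_zero (f := fun c b => h b c) (g := fun c a => g a c) hh1 hg1
  rw [t1, t2, t3, t4, t5, t6, t7, t8, t9]
  simp

end K4

/-! ### Cross products in characteristic two -/

namespace V

theorem exists_cross : ∀ x : V, ∃ u v, cross u v = x := by decide +kernel

theorem exists_dot : ∀ x : V, x ≠ 0 → ∃ p, dot x p = 1 := by decide +kernel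

theorem cross_cross (p q r : V) : cross (cross p q) (cross p r) = dot (cross p q) r • p := by
  have := K4.two_eq_zero
  rw [ext_iff']
  simp only [cross, dot, Pi.smul_apply, smul_eq_mul, Matrix.cons_val]
  refine ⟨?_, ?_, ?_⟩ <;> grind

theorem cross_comm (u v : V) : cross u v = cross v u := by
  rw [ext_iff']
  simp only [cross, Matrix.cons_val]
  refine ⟨?_, ?_, ?_⟩ <;> ring

theorem cross_self (u : V) : cross u u = 0 := by
  have := K4.two_eq_zero
  rw [ext_iff']
  simp only [cross, Matrix.cons_val, Pi.zero_apply]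
  refine ⟨?_, ?_, ?_⟩ <;> grind

theorem cross_add (u v w : V) : cross u (v + w) = cross u v + cross u w := by
  rw [ext_iff']
  simp only [cross, Matrix.cons_val, Pi.add_apply]
  refine ⟨?_, ?_, ?_⟩ <;> ring

theorem add_cross (u v w : V) : cross (u + v) w = cross u w + cross v w := by
  rw [cross_comm, cross_add, cross_comm w, cross_comm w]

theorem cross_smul (c : K4) (u v : V) : cross u (c • v) = c • cross u v := by
  rw [ext_iff']
  simp only [cross, Matrix.cons_val, Pi.smul_apply, smul_eq_mul]
  refine ⟨?_, ?_, ?_⟩ <;> ring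

theorem smul_cross (c : K4) (u v : V) : cross (c • u) v = c • cross u v := by
  rw [cross_comm, cross_smul, cross_comm]

theorem dot_cross_self (u v : V) : dot u (cross u v) = 0 := by
  have := K4.two_eq_zero
  simp only [cross, dot, Matrix.cons_val]; grind

theorem dot_cross_comm (u v w : V) : dot (cross u v) w = dot (cross v w) u := by
  simp only [cross, dot, Matrix.cons_val]; ring

/-- Cramer's rule, with a third vector `p` that makes the determinant 1. -/
theorem exists_combination {u v x : V} (h : cross u v ≠ 0) (hx : dot x (cross u v) = 0) :
    ∃ a b : K4, x = a • u + b • v := by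
  obtain ⟨p, hp⟩ := exists_dot _ h
  refine ⟨dot x (cross v p), dot x (cross p u), ?_⟩
  have := K4.two_eq_zero
  rw [ext_iff']
  simp only [cross, dot, Pi.add_apply, Pi.smul_apply, smul_eq_mul, Matrix.cons_val] at *
  refine ⟨?_, ?_, ?_⟩ <;> grind

/-- The coordinatewise application of `σ`. -/
def twist (σ : K4 →+* K4) (x : V) : V := fun k => σ (x k)

theorem twist_add (σ : K4 →+* K4) (x y : V) : twist σ (x + y) = twist σ x + twist σ y :=
  funext fun _ => map_add σ _ _

theorem twist_smul (σ : K4 →+* K4) (c : K4) (x : V) : twist σ (c • x) = σ c • twist σ x :=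
  funext fun _ => map_mul σ _ _

theorem twist_zero (σ : K4 →+* K4) : twist σ 0 = 0 := funext fun _ => map_zero σ

end V

/-! ### The defect of a homogeneous map and the form it induces -/

/-- The deviation of `g` from additivity at `u`, `v`, measured on the line through them. -/
def defect (σ : K4 →+* K4) (g : V → V) (u v : V) : K4 :=
  dot (g u + g v + g (u + v)) (twist σ (cross u v))

theorem defect_of_cross_eq_zero (σ : K4 →+* K4) (g : V → V) {u v : V} (h : cross u v = 0) :
    defect σ g u v = 0 := by
  rw [defect, h, twist_zero, dot_zero]

/-- The factor by which `defect` scales. -/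
def scale (σ : K4 →+* K4) (c : K4) : K4 := σ c * c ^ 2

theorem scale_mul (σ : K4 →+* K4) (a b : K4) : scale σ (a * b) = scale σ a * scale σ b := by
  rw [scale, scale, scale, map_mul]; ring

theorem scale_pow_three (σ : K4 →+* K4) {c : K4} (hc : c ≠ 0) : scale σ c ^ 3 = 1 :=
  K4.pow_three _ (mul_ne_zero ((map_ne_zero σ).2 hc) (pow_ne_zero _ hc))

section

variable {σ : K4 →+* K4} {g : V → V} (hg : ∀ (c : K4) v, g (c • v) = c • g v)
  (hD : ∀ u v, cross u v ≠ 0 → defect σ g u v ≠ 0)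

include hg hD

/-- Paired with the fixed vector X, the map g becomes a homogeneous scalar function on the plane of
u and v that is nowhere additive, and such a function is known from three values. -/
theorem dot_combination {u v : V} (h : cross u v ≠ 0) (a b : K4) :
    dot (g (a • u + b • v)) (twist σ (cross u v)) =
      a * dot (g u) (twist σ (cross u v)) + b * dot (g v) (twist σ (cross u v)) +
        a ^ 2 * b ^ 2 * defect σ g u v := by
  set X := twist σ (cross u v) with hX
  have h2 := K4.two_eq_zero
  have hω := K4.ω_mul_ω
  have key : ∀ p q s : V, ∀ d : K4, d ≠ 0 → cross p q = d • cross u v → p + q = s →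
      dot (g p) X + dot (g q) X + dot (g s) X ≠ 0 := by
    rintro p q s d hd hpq rfl h0
    refine hD p q (by rw [hpq]; exact smul_ne_zero hd h) ?_
    rw [defect, hpq, twist_smul, dot_smul, add_dot, add_dot, h0, mul_zero]
  have hω0 : K4.ω ≠ 0 := by decide
  have hω1 : K4.ω + 1 ≠ 0 := by decide
  have vecs : ∀ p q : V, p = q ↔ ∀ k, p k = q k := fun p q => funext_iff
  have smul_g : ∀ (c : K4) w, dot (g (c • w)) X = c * dot (g w) X := fun c w => by
    rw [hg, smul_dot]
  -- The seven triples used are among the five projective points u, v, u+v, u+ωv, u+(ω+1)v, scaled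
  -- to have sum zero.
  have k1 := key u v (u + v) 1 one_ne_zero (by rw [one_smul]) rfl
  have k2 := key u (K4.ω • v) (u + K4.ω • v) K4.ω hω0 (cross_smul _ _ _) rfl
  have k3 := key u ((K4.ω + 1) • v) (u + (K4.ω + 1) • v) _ hω1 (cross_smul _ _ _) rfl
  have k4 := key (u + v) (u + K4.ω • v) ((K4.ω + 1) • v) (K4.ω + 1) hω1
    (by
      simp only [cross_add, add_cross, cross_smul, V.cross_self, cross_comm v u, vecs, Pi.add_apply,
        Pi.smul_apply, smul_eq_mul, Pi.zero_apply]
      intro k; grind)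
    (by
      simp only [vecs, Pi.add_apply, Pi.smul_apply, smul_eq_mul]
      intro k; grind)
  have k5 := key (u + v) (u + (K4.ω + 1) • v) (K4.ω • v) K4.ω hω0
    (by
      simp only [cross_add, add_cross, cross_smul, V.cross_self, cross_comm v u, vecs, Pi.add_apply,
        Pi.smul_apply, smul_eq_mul, Pi.zero_apply]
      intro k; grind)
    (by
      simp only [vecs, Pi.add_apply, Pi.smul_apply, smul_eq_mul]
      intro k; grind)
  have k6 := key (u + K4.ω • v) (u + (K4.ω + 1) • v) v 1 one_ne_zero
    (by
      simp only [cross_add, add_cross, cross_smul, smul_cross, cross_self, cross_comm v u, vecs,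
        Pi.add_apply, Pi.smul_apply, smul_eq_mul, Pi.zero_apply]
      intro k; grind)
    (by
      simp only [vecs, Pi.add_apply, Pi.smul_apply, smul_eq_mul]
      intro k; grind)
  have k7 := key (u + v) (K4.ω • (u + K4.ω • v)) ((K4.ω + 1) • (u + (K4.ω + 1) • v)) 1 one_ne_zero
    (by
      simp only [cross_add, add_cross, cross_smul, cross_self, cross_comm v u, vecs,
        Pi.add_apply, Pi.smul_apply, smul_eq_mul, Pi.zero_apply]
      intro k; grind)
    (by
      simp only [vecs, Pi.add_apply, Pi.smul_apply, smul_eq_mul]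
      intro k; grind)
  simp only [smul_g] at k2 k3 k4 k5 k7
  obtain ⟨e1, e2⟩ := K4.values_of_nonadditive _ _ _ k1 _ k2 k4 _ k3 k5 k6 k7
  have hd : defect σ g u v = dot (g u) X + dot (g v) X + dot (g (u + v)) X := by
    rw [defect, add_dot, add_dot]
  rw [hd]
  have ht : ∀ t : K4, dot (g (u + t • v)) X = dot (g u) X + t * dot (g v) X +
      t ^ 2 * (dot (g u) X + dot (g v) X + dot (g (u + v)) X) := by
    rw [K4.forall_iff]
    refine ⟨by simp, ?_, e1, ?_⟩
    · rw [one_smul]; grind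
    · rw [hω]; exact e2
  by_cases ha : a = 0
  · rw [ha, zero_smul, zero_add, smul_g]; ring
  · have e : a • u + b • v = a • (u + (a⁻¹ * b) • v) := by
      rw [smul_add, smul_smul, mul_inv_cancel_left₀ ha]
    have ha3 := K4.pow_three a ha
    have hai : a⁻¹ = a ^ 2 := by
      apply mul_left_cancel₀ ha
      rw [mul_inv_cancel₀ ha, ← ha3]; ring
    rw [e, smul_g, ht, hai]
    linear_combination (b * dot (g v) X + a ^ 2 * b ^ 2 *
      (dot (g u) X + dot (g v) X + dot (g (u + v)) X)) * ha3

/-- Such pairs differ by a base change of determinant 1, and by `dot_combination` a base change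
multiplies the defect, for fixed X, by a²b² + c²d² + (a+c)²(b+d)² = (ad+bc)². -/
theorem defect_eq_of_cross_eq {u v u' v' : V} (h : cross u v = cross u' v') :
    defect σ g u v = defect σ g u' v' := by
  have h2 := K4.two_eq_zero
  by_cases h0 : cross u v = 0
  · rw [defect_of_cross_eq_zero _ _ h0, defect_of_cross_eq_zero _ _ (h ▸ h0)]
  obtain ⟨a, b, hu⟩ := exists_combination h0 (x := u') (by rw [h, dot_cross_self])
  obtain ⟨c, d, hv⟩ := exists_combination h0 (x := v') (by rw [h, cross_comm, dot_cross_self])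
  have hdet : a * d + b * c = 1 := by
    have e : cross u' v' = (a * d + b * c) • cross u v := by
      rw [hu, hv]
      simp only [cross_add, add_cross, cross_smul, smul_cross, cross_self, cross_comm v u,
        smul_zero, add_zero, zero_add, smul_smul, add_smul]
      rw [add_comm, mul_comm d, mul_comm c]
    apply smul_left_injective K4 h0
    simp only [one_smul]
    rw [← e, h]
  have huv : u' + v' = (a + c) • u + (b + d) • v := by
    rw [hu, hv, add_smul, add_smul]; abel
  have e : defect σ g u' v' = dot (g u') (twist σ (cross u v)) +
      dot (g v') (twist σ (cross u v)) + dot (g (u' + v')) (twist σ (cross u v)) := by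
    rw [defect, ← h, add_dot, add_dot]
  rw [e, huv, hu, hv, dot_combination hg hD h0, dot_combination hg hD h0,
    dot_combination hg hD h0]
  have h3 : (a * d + b * c) ^ 2 = 1 := by rw [hdet, one_pow]
  grind

omit hg hD in
/-- The value of the defect on pairs with a given cross product. -/
noncomputable def form (σ : K4 →+* K4) (g : V → V) (x : V) : K4 :=
  defect σ g (exists_cross x).choose (exists_cross x).choose_spec.choose

theorem defect_eq_form (u v : V) : defect σ g u v = form σ g (cross u v) :=
  defect_eq_of_cross_eq hg hD (exists_cross (cross u v)).choose_spec.choose_spec.symm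

theorem form_zero : form σ g 0 = 0 := by
  rw [← V.cross_self 0, ← defect_eq_form hg hD, defect_of_cross_eq_zero _ _ (V.cross_self _)]

theorem form_ne_zero {x : V} (hx : x ≠ 0) : form σ g x ≠ 0 := by
  obtain ⟨u, v, rfl⟩ := exists_cross x
  rw [← defect_eq_form hg hD]
  exact hD u v hx

/-- Replacing u by cu contributes σ(c) through the twisted cross product and c² through
`dot_combination`. -/
theorem form_smul (c : K4) (x : V) : form σ g (c • x) = scale σ c * form σ g x := by
  by_cases hx : x = 0
  · rw [hx, smul_zero, form_zero hg hD, mul_zero]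
  obtain ⟨u, v, rfl⟩ := exists_cross x
  have h := dot_combination hg hD hx c 1
  rw [one_smul] at h
  have h2 := K4.two_eq_zero
  rw [← smul_cross, ← defect_eq_form hg hD, ← defect_eq_form hg hD, defect, smul_cross, twist_smul,
    dot_smul, add_dot, add_dot, h, hg, smul_dot, scale]
  grind

/-- The sum of the form over a Fano subplane vanishes. -/
theorem form_fano {p q r : V} (h : dot (cross p q) r ≠ 0) :
    form σ g p + form σ g q + form σ g r + form σ g (p + q) + form σ g (p + r) +
      form σ g (q + r) + form σ g (p + q + r) = 0 := by
  have h2 := K4.two_eq_zero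
  set t := dot (cross p q) r with ht
  have ht3 := K4.pow_three t h
  -- The scaling by t, where t³ = 1, makes u × v = p, u × w = q and v × w = r.
  set u := t • cross p q with hu
  set v := t • cross p r with hv
  set w := t • cross q r with hw
  have ht4 : t * t * t = 1 := by rw [← ht3]; ring
  have cp : cross u v = p := by
    rw [hu, hv, smul_cross, cross_smul, V.cross_cross, ← ht, smul_smul, smul_smul, ht4, one_smul]
  have cq : cross u w = q := by
    rw [hu, hw, smul_cross, cross_smul, cross_comm p q, V.cross_cross, cross_comm q p, ← ht,
      smul_smul, smul_smul, ht4, one_smul]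
  have cr : cross v w = r := by
    rw [hv, hw, smul_cross, cross_smul, cross_comm p r, cross_comm q r, V.cross_cross,
      dot_cross_comm, ← ht, smul_smul, smul_smul, ht4, one_smul]
  have c1 : cross u (v + w) = p + q := by rw [cross_add, cp, cq]
  have c2 : cross v (u + w) = p + r := by rw [cross_add, cross_comm v u, cp, cr]
  have c3 : cross w (u + v) = q + r := by rw [cross_add, cross_comm w, cross_comm w, cq, cr]
  have c4 : cross (u + v) (u + w) = p + q + r := by
    rw [cross_add, add_cross, add_cross, V.cross_self, cross_comm v u, cp, cq, cr]; abel
  have e1 : v + (u + w) = u + (v + w) := by abel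
  have e2 : w + (u + v) = u + (v + w) := by abel
  have e3 : u + v + (u + w) = v + w := by
    rw [← CharTwo.add_cancel_left u (v + w)]; abel
  have d0 := defect_eq_form hg hD u v
  have d1 := defect_eq_form hg hD u w
  have d2 := defect_eq_form hg hD v w
  have d3 := defect_eq_form hg hD u (v + w)
  have d4 := defect_eq_form hg hD v (u + w)
  have d5 := defect_eq_form hg hD w (u + v)
  have d6 := defect_eq_form hg hD (u + v) (u + w)
  rw [defect] at d0 d1 d2 d3 d4 d5 d6
  rw [cp] at d0
  rw [cq] at d1
  rw [cr] at d2
  rw [c1] at d3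
  rw [c2, e1] at d4
  rw [c3, e2] at d5
  rw [c4, e3] at d6
  -- Each value of g is paired with the sum of the cross products of the three Fano lines through
  -- its argument, and this sum is zero.
  rw [← d0, ← d1, ← d2, ← d3, ← d4, ← d5, ← d6]
  simp only [twist_add, add_dot, dot_add]
  grind

/-- The sum of the form over an affine line depends only on its direction. -/
theorem sum_form_line {u v w : V} (h : dot (cross u v) w ≠ 0) :
    ∑ c : K4, form σ g (u + c • v) = ∑ c : K4, form σ g (c • v) := by
  have h2 := K4.two_eq_zero
  have hω := K4.ω_mul_ω
  have hω0 : K4.ω ≠ 0 := by decide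
  have hω1 : K4.ω + 1 ≠ 0 := by decide
  have hz3 := scale_pow_three σ hω0
  have hz2 : scale σ (K4.ω + 1) = scale σ K4.ω ^ 2 := by rw [← hω, scale_mul, sq]
  -- Three Fano subplanes through v, chosen so that with weights z², 1, z (where z = `scale σ ω` and
  -- z³ = 1) all terms involving w cancel.
  have hA := form_fano hg hD (p := v) (q := K4.ω • u) (r := w) (by
    rw [cross_smul, smul_dot, cross_comm]; exact mul_ne_zero hω0 h)
  have hB := form_fano hg hD (p := v) (q := u) (r := (K4.ω + 1) • w) (by
    rw [dot_smul, cross_comm]; exact mul_ne_zero hω1 h)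
  have hC := form_fano hg hD (p := v) (q := (K4.ω + 1) • u) (r := K4.ω • (w + v)) (by
    rw [cross_smul, smul_dot, dot_smul, dot_add, cross_comm v u, dot_comm _ v, cross_comm u v,
      dot_cross_self, add_zero, cross_comm v u]
    exact mul_ne_zero hω1 (mul_ne_zero hω0 h))
  have vecs : ∀ p q : V, p = q ↔ ∀ k, p k = q k := fun p q => funext_iff
  have a1 : v + K4.ω • u = K4.ω • (u + (K4.ω + 1) • v) := by
    simp only [vecs, Pi.add_apply, Pi.smul_apply, smul_eq_mul]; intro k; grind
  have a2 : v + w = w + v := add_comm _ _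
  have a3 : K4.ω • u + w = w + K4.ω • u := add_comm _ _
  have a4 : v + K4.ω • u + w = w + K4.ω • u + v := by abel
  have b1 : v + u = u + v := add_comm _ _
  have b2 : v + (K4.ω + 1) • w = (K4.ω + 1) • (w + K4.ω • v) := by
    simp only [vecs, Pi.add_apply, Pi.smul_apply, smul_eq_mul]; intro k; grind
  have b3 : u + (K4.ω + 1) • w = (K4.ω + 1) • (w + K4.ω • u) := by
    simp only [vecs, Pi.add_apply, Pi.smul_apply, smul_eq_mul]; intro k; grind
  have b4 : v + u + (K4.ω + 1) • w = (K4.ω + 1) • (w + K4.ω • u + K4.ω • v) := by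
    simp only [vecs, Pi.add_apply, Pi.smul_apply, smul_eq_mul]; intro k; grind
  have c1 : v + (K4.ω + 1) • u = (K4.ω + 1) • (u + K4.ω • v) := by
    simp only [vecs, Pi.add_apply, Pi.smul_apply, smul_eq_mul]; intro k; grind
  have c2 : v + K4.ω • (w + v) = K4.ω • (w + K4.ω • v) := by
    simp only [vecs, Pi.add_apply, Pi.smul_apply, smul_eq_mul]; intro k; grind
  have c3 : (K4.ω + 1) • u + K4.ω • (w + v) = K4.ω • (w + K4.ω • u + v) := by
    simp only [vecs, Pi.add_apply, Pi.smul_apply, smul_eq_mul]; intro k; grind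
  have c4 : v + (K4.ω + 1) • u + K4.ω • (w + v) = K4.ω • (w + K4.ω • u + K4.ω • v) := by
    simp only [vecs, Pi.add_apply, Pi.smul_apply, smul_eq_mul]; intro k; grind
  rw [a4, a3, a2, a1] at hA
  rw [b4, b3, b2, b1] at hB
  rw [c4, c3, c2, c1] at hC
  simp only [form_smul hg hD, hz2] at hA hB hC
  rw [K4.sum_eq, K4.sum_eq]
  simp only [zero_smul, one_smul, add_zero, form_smul hg hD, hz2, form_zero hg hD]
  generalize scale σ K4.ω = z at *
  generalize form σ g (u + K4.ω • v) = x1 at *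
  generalize form σ g (u + (K4.ω + 1) • v) = x2 at *
  generalize form σ g (u + v) = x3 at *
  generalize form σ g u = x4 at *
  generalize form σ g v = x5 at *
  generalize form σ g w = x6 at *
  generalize form σ g (w + v) = x7 at *
  generalize form σ g (w + K4.ω • v) = x8 at *
  generalize form σ g (w + K4.ω • u) = x9 at *
  generalize form σ g (w + K4.ω • u + v) = x10 at *
  generalize form σ g (w + K4.ω • u + K4.ω • v) = x11 at *
  clear a1 a2 a3 a4 b1 b2 b3 b4 c1 c2 c3 c4 vecs h hω hω0 hω1 hz2
  linear_combination z ^ 2 * hA + hB + z * hC + (-(x1 + x2)) * hz3 -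
    (x4 * z ^ 3 + (1 + z + z ^ 2) * x5 + z ^ 2 * (x6 + x7 + x8 + x9 + x10 + x11)) * h2

/-- In a lift of the dual plane, some three lines are concurrent. -/
theorem defect_lift_false : False := by
  have h2 := K4.two_eq_zero
  set F : K4 → K4 → K4 → K4 := fun a b c => form σ g ![a, b, c] with hF
  have line : ∀ (a : K4) (u v w : V), dot (cross u v) w ≠ 0 →
      ∑ c : K4, form σ g (a • u + c • v) = ∑ c : K4, form σ g (c • v) := by
    intro a u v w h
    by_cases ha : a = 0
    · simp only [ha, zero_smul, zero_add]
    · exact sum_form_line hg hD (w := w) (by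
        rw [smul_cross, smul_dot]; exact mul_ne_zero ha h)
  have vec : ∀ a b c a' b' c' : K4, ∀ x y : K4, x • (![a, b, c] : V) + y • ![a', b', c'] =
      ![x * a + y * a', x * b + y * b', x * c + y * c'] := by
    intro a b c a' b' c' x y; ext k; fin_cases k <;> rfl
  have vec' : ∀ a b c : K4, ∀ x : K4, x • (![a, b, c] : V) = ![x * a, x * b, x * c] := by
    intro a b c x; ext k; fin_cases k <;> rfl
  have l1 : ∀ a, ∑ b, F a b 0 = ∑ b, F 0 b 0 := fun a => by
    simpa [vec, vec', hF] using line a ![1, 0, 0] ![0, 1, 0] ![0, 0, 1] (by decide)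
  have l2 : ∀ b, ∑ a, F a b 0 = ∑ a, F a 0 0 := fun a => by
    simpa [vec, vec', hF] using line a ![0, 1, 0] ![1, 0, 0] ![0, 0, 1] (by decide)
  have l3 : ∀ a, ∑ c, F a 0 c = ∑ c, F 0 0 c := fun a => by
    simpa [vec, vec', hF] using line a ![1, 0, 0] ![0, 0, 1] ![0, 1, 0] (by decide)
  have l4 : ∀ c, ∑ a, F a 0 c = ∑ a, F a 0 0 := fun a => by
    simpa [vec, vec', hF] using line a ![0, 0, 1] ![1, 0, 0] ![0, 1, 0] (by decide)
  have l5 : ∀ b, ∑ c, F 0 b c = ∑ c, F 0 0 c := fun a => by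
    simpa [vec, vec', hF] using line a ![0, 1, 0] ![0, 0, 1] ![1, 0, 0] (by decide)
  have l6 : ∀ c, ∑ b, F 0 b c = ∑ b, F 0 b 0 := fun a => by
    simpa [vec, vec', hF] using line a ![0, 0, 1] ![0, 1, 0] ![1, 0, 0] (by decide)
  -- This is the Fano relation for multiples of the unit vectors, with the three axis terms
  -- distributed over the coordinate planes.
  have split : ∀ a b c, F a b c =
      (F a b 0 + F a 0 0) + (F a 0 c + F 0 0 c) + (F 0 b c + F 0 b 0) := by
    have h0 : F 0 0 0 = 0 := by
      have : (![0, 0, 0] : V) = 0 := by decide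
      rw [hF]; simp only [this]; exact form_zero hg hD
    intro a b c
    by_cases ha : a = 0
    · subst ha; grind
    by_cases hb : b = 0
    · subst hb; grind
    by_cases hc : c = 0
    · subst hc; grind
    have := form_fano hg hD (p := ![a, 0, 0]) (q := ![0, b, 0]) (r := ![0, 0, c]) (by
      simp [cross, dot, ha, hb, hc])
    have e1 : (![a, 0, 0] : V) + ![0, b, 0] = ![a, b, 0] := by ext k; fin_cases k <;> simp
    have e2 : (![a, 0, 0] : V) + ![0, 0, c] = ![a, 0, c] := by ext k; fin_cases k <;> simp
    have e3 : (![0, b, 0] : V) + ![0, 0, c] = ![0, b, c] := by ext k; fin_cases k <;> simp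
    have e4 : (![a, b, 0] : V) + ![0, 0, c] = ![a, b, c] := by ext k; fin_cases k <;> simp
    rw [e1, e2, e3, e4] at this
    simp only [hF]
    grind
  have hz := K4.sum_cube_eq_zero (f := fun a b => F a b 0 + F a 0 0)
    (g := fun a c => F a 0 c + F 0 0 c) (h := fun b c => F 0 b c + F 0 b 0)
    (f1 := _) (f2 := _) (g1 := _) (g2 := _) (h1 := _) (h2 := _)
    (fun b => by rw [Finset.sum_add_distrib, l2])
    (fun a => by rw [Finset.sum_add_distrib, l1, K4.sum_const_eq_zero])
    (fun c => by rw [Finset.sum_add_distrib, l4, K4.sum_const_eq_zero])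
    (fun a => by rw [Finset.sum_add_distrib, l3])
    (fun c => by rw [Finset.sum_add_distrib, l6])
    (fun b => by rw [Finset.sum_add_distrib, l5, K4.sum_const_eq_zero])
  simp only [← split] at hz
  -- The cubes add up to the number of nonzero vectors, 63, which is odd.
  have hcube : ∀ a b c, F a b c ^ 3 = if a = 0 ∧ b = 0 ∧ c = 0 then 0 else 1 := by
    intro a b c
    split_ifs with h
    · obtain ⟨rfl, rfl, rfl⟩ := h
      rw [split]; grind
    · refine K4.pow_three _ (form_ne_zero hg hD fun h0 => h ?_)
      exact ⟨congrFun h0 0, congrFun h0 1, congrFun h0 2⟩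
  simp only [hcube] at hz
  revert hz
  decide +kernel

end

/-! ### From a dual hyperoval to a nowhere additive map -/

namespace ChainData

variable {R : Type*} [Ring R]

theorem twist_rep (D : ChainData R) (i : Fin 21) : twist D.σ (rep i) = rep (D.τ i) :=
  funext fun k => D.σ_rep i k

theorem cross_smul_self (a b : K4) (r : V) : cross (a • r) (b • r) = 0 := by
  rw [smul_cross, cross_smul, V.cross_self, smul_zero, smul_zero]

/-- The homogeneous extension of a function on the projective plane. -/
theorem exists_homogeneous (f : Fin 21 → V) : ∃ g : V → V,
    (∀ (c : K4) i, g (c • rep i) = c • f i) ∧ ∀ (c : K4) v, g (c • v) = c • g v := by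
  classical
  choose! J d hd using exists_rep
  let g : V → V := fun v => if v = 0 then 0 else d v • f (J v)
  have h1 : ∀ (c : K4) i, g (c • rep i) = c • f i := by
    intro c i
    by_cases hc : c = 0
    · simp [g, hc]
    have h : c • rep i ≠ 0 := smul_ne_zero hc (rep_ne_zero i)
    obtain ⟨hd, he⟩ := hd _ h
    obtain ⟨hj, hcd⟩ := eq_of_rep_eq_smul (J (c • rep i)) i ((d (c • rep i))⁻¹ * c)
      (by rw [mul_smul]; exact (eq_inv_smul_iff₀ hd).2 he)
    simp only [g, if_neg h]
    rw [hj, (inv_mul_eq_one₀ hd).1 hcd]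
  refine ⟨g, h1, fun c v => ?_⟩
  by_cases hv : v = 0
  · simp [g, hv]
  · obtain ⟨i, d, -, rfl⟩ := exists_rep v hv
    rw [smul_smul, h1, h1, smul_smul]

/-- If the residue map has a multiplicative and additive section, there is no dual hyperoval. -/
theorem not_exists_isDualHyperoval [Finite R] (D : ChainData R)
    (hp : ∀ j i, dot (rep j) (rep i) = 0 → D.pairing j i = 0) :
    ¬ ∃ H, IsDualHyperoval R H := by
  rintro ⟨H, hH⟩
  have := Fintype.ofFinite (Point R)
  have := Fintype.ofFinite (Line R)
  obtain ⟨f, hf⟩ := D.coordinates.dual.exists_of_hyperoval hH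
  obtain ⟨g, hg1, hg⟩ := exists_homogeneous fun j => f (D.τ j)
  have hinc : ∀ i j y, dot (rep j) (rep i) = 0 →
      dot (rep j) y = dot (f (D.τ j)) (rep (D.τ i)) →
      DualInc R (D.coordinates.dual.pt (D.τ j, f (D.τ j))) (D.pt (i, y)) := by
    intro i j y h1 h2
    change Inc R (D.pt (i, y)) (D.ln (D.τ (D.τ j), f (D.τ j)))
    rw [D.τ_τ, D.inc_iff, hp j i h1, h2]
    exact ⟨h1, CharTwo.add_self_eq_zero _⟩
  have hτ : ∀ {i j}, i ≠ j → D.τ i ≠ D.τ j :=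
    fun {i j} hij h => hij (by rw [← D.τ_τ i, h, D.τ_τ])
  refine defect_lift_false (σ := D.σ) hg fun u v huv h0 => ?_
  obtain ⟨i, e, he, hi⟩ := exists_rep _ huv
  have hu0 : u ≠ 0 := by rintro rfl; exact huv (by simp [cross])
  have hv0 : v ≠ 0 := by rintro rfl; exact huv (by simp [cross])
  have hu1 : cross u (u + v) ≠ 0 := by rwa [cross_add, V.cross_self, zero_add]
  have hv1 : cross v (u + v) ≠ 0 := by rwa [cross_add, V.cross_self, add_zero, cross_comm]
  have hw0 : u + v ≠ 0 := by
    intro h; rw [h] at hu1; exact hu1 (by simp [cross])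
  have ou : dot u (rep i) = 0 := by
    have := V.dot_cross_self u v
    rwa [← hi, dot_smul, mul_eq_zero_iff_left he] at this
  have ov : dot v (rep i) = 0 := by
    have := V.dot_cross_self v u
    rwa [cross_comm, ← hi, dot_smul, mul_eq_zero_iff_left he] at this
  have ow : dot (u + v) (rep i) = 0 := by rw [add_dot, ou, ov, add_zero]
  have hsum : dot (g u) (rep (D.τ i)) + dot (g v) (rep (D.τ i)) =
      dot (g (u + v)) (rep (D.τ i)) := by
    rw [defect, ← hi, twist_smul, dot_smul, twist_rep,
      mul_eq_zero_iff_left ((map_ne_zero _).2 he), add_dot, add_dot, CharTwo.add_eq_zero] at h0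
    exact h0
  obtain ⟨j, a, ha, hu⟩ := exists_rep u hu0
  obtain ⟨k, b, hb, hv⟩ := exists_rep v hv0
  obtain ⟨l, d, hd, hw⟩ := exists_rep (u + v) hw0
  have hjk : j ≠ k := by
    rintro rfl; exact huv (by rw [← hu, ← hv, cross_smul_self])
  have hjl : j ≠ l := by
    rintro rfl; exact hu1 (by rw [← hw, ← hu, cross_smul_self])
  have hkl : k ≠ l := by
    rintro rfl; exact hv1 (by rw [← hw, ← hv, cross_smul_self])
  obtain ⟨p, hp1, hp2⟩ := exists_dual j k hjk
  obtain ⟨q, hq1, hq2⟩ := exists_dual k j hjk.symm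
  -- The point (i, y) lies on the lines chosen for u and v; if the defect vanishes, additivity puts
  -- it on the line chosen for u + v too.
  set y : V := dot (f (D.τ j)) (rep (D.τ i)) • p + dot (f (D.τ k)) (rep (D.τ i)) • q with hy
  have y1 : dot (rep j) y = dot (f (D.τ j)) (rep (D.τ i)) := by
    rw [dot_comm, hy, add_dot, smul_dot, smul_dot, hp1, hq2, mul_one, mul_zero, add_zero]
  have y2 : dot (rep k) y = dot (f (D.τ k)) (rep (D.τ i)) := by
    rw [dot_comm, hy, add_dot, smul_dot, smul_dot, hp2, hq1, mul_one, mul_zero, zero_add]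
  have y3 : dot (rep l) y = dot (f (D.τ l)) (rep (D.τ i)) := by
    apply mul_left_cancel₀ hd
    rw [← smul_dot, hw, add_dot, ← hu, ← hv, smul_dot, smul_dot, y1, y2, ← smul_dot, ← smul_dot,
      ← hg1, ← hg1, hu, hv, hsum, ← hw, hg1, smul_dot]
  have ortho : ∀ {c : K4} {j}, c ≠ 0 → dot (c • rep j) (rep i) = 0 → dot (rep j) (rep i) = 0 :=
    fun hc h => by rwa [smul_dot, mul_eq_zero_iff_left hc] at h
  exact hf (D.τ j) (D.τ k) (D.τ l) (hτ hjk) (hτ hjl) (hτ hkl) (D.pt (i, y))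
    ⟨hinc _ _ _ (ortho ha (hu ▸ ou)) y1, hinc _ _ _ (ortho hb (hv ▸ ov)) y2,
      hinc _ _ _ (ortho hd (hw ▸ ow)) y3⟩

end ChainData

/-! ## The truncated skew polynomial rings -/

theorem nonempty_ringEquiv_K4 : Nonempty (F4 ≃+* K4) := by
  have := Fintype.ofFinite F4
  refine ⟨FiniteField.ringEquivOfCardEq (K := F4) (K' := K4) ?_⟩
  rw [K4.card_eq, ← Nat.card_eq_fintype_card, GaloisField.card 2 2 two_ne_zero]
  norm_num

/-- The chain ring data of a truncated skew polynomial ring over the field with four elements. -/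
noncomputable def truncSkewPolyData (φ : F4 →+* F4) (hφ : (∀ a, φ a = a) ∨ ∀ a, φ a = a * a) :
    ChainData (TruncSkewPoly F4 φ) :=
  let e := nonempty_ringEquiv_K4.some
  { π := 
      { toFun := fun x => e x.const
        map_one' := by simp
        map_mul' := by simp
        map_zero' := by simp
        map_add' := by simp }
    ι := 
      { toFun := fun b => ⟨0, e.symm b⟩
        map_zero' := by ext <;> simp
        map_add' := fun a b => by ext <;> simp }
    σ := (e : F4 →+* K4).comp (φ.comp (e.symm : K4 →+* F4))
    s := fun a => TruncSkewPoly.C (e.symm a)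
    π_s := fun a => by simp
    ι_injective := fun a b h => e.symm.injective (congrArg TruncSkewPoly.lin h)
    π_ι := fun b => by simp
    exists_ι := fun x hx => ⟨e x.lin, by
      have : x.const = 0 := by simpa using hx
      ext <;> simp [this]⟩
    mul_ι := fun r b => by ext <;> simp
    ι_mul := fun r b => by ext <;> simp
    σ_eq := hφ.imp (fun h a => by simp [h]) (fun h a => by simp [h]) }

/-- The scalars form a subring, so products of lifted vectors have no carry. -/
theorem truncSkewPolyData_pairing (φ : F4 →+* F4) (hφ : (∀ a, φ a = a) ∨ ∀ a, φ a = a * a)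
    (j i : Fin 21) (h : dot (rep j) (rep i) = 0) : (truncSkewPolyData φ hφ).pairing j i = 0 := by
  set D := truncSkewPolyData φ hφ
  have hs : ∀ a : K4, D.s a = TruncSkewPoly.C (nonempty_ringEquiv_K4.some.symm a) := fun _ => rfl
  have h0 : D.vec (rep j) 0 ⬝ᵥ D.vec (rep i) 0 = D.ι 0 := by
    simp only [dotProduct, Fin.sum_univ_three, ChainData.vec, Pi.zero_apply, map_zero, add_zero, hs,
      ← map_mul, ← map_add]
    change TruncSkewPoly.C (nonempty_ringEquiv_K4.some.symm (dot (rep j) (rep i))) = 0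
    rw [h, map_zero, map_zero]
  rw [ChainData.pairing, h0, Function.leftInverse_invFun D.ι_injective]

theorem exists_chainData_S4 :
    ∃ D : ChainData S4, ∀ j i, dot (rep j) (rep i) = 0 → D.pairing j i = 0 :=
  ⟨truncSkewPolyData _ (Or.inl fun _ => rfl), truncSkewPolyData_pairing _ _⟩

theorem exists_chainData_T4 :
    ∃ D : ChainData T4, ∀ j i, dot (rep j) (rep i) = 0 → D.pairing j i = 0 :=
  ⟨truncSkewPolyData _ (Or.inr fun a => by rw [frobenius_def, sq]), truncSkewPolyData_pairing _ _⟩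

/-! ## The Galois ring -/

namespace Galois

/-- The element `x + y ω` of the Galois ring. -/
noncomputable def elt (x y : ZMod 4) : G4 := AdjoinRoot.of _ x + AdjoinRoot.of _ y * AdjoinRoot.root _

theorem root_mul_root : (AdjoinRoot.root _ * AdjoinRoot.root _ : G4) =
    -1 - AdjoinRoot.root (Polynomial.X ^ 2 + Polynomial.X + 1 : (ZMod 4)[X]) := by
  have h := AdjoinRoot.eval₂_root (Polynomial.X ^ 2 + Polynomial.X + 1 : (ZMod 4)[X])
  simp only [Polynomial.eval₂_add, Polynomial.eval₂_pow, Polynomial.eval₂_X,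
    Polynomial.eval₂_one] at h
  linear_combination h

theorem elt_add (x y z w : ZMod 4) : elt x y + elt z w = elt (x + z) (y + w) := by
  simp only [elt, map_add]; ring

theorem elt_mul (x y z w : ZMod 4) :
    elt x y * elt z w = elt (x * z - y * w) (x * w + y * z - y * w) := by
  simp only [elt, map_add, map_sub, map_mul]
  linear_combination AdjoinRoot.of _ y * AdjoinRoot.of _ w * root_mul_root

theorem elt_surjective (r : G4) : ∃ x y, elt x y = r := by
  induction r using AdjoinRoot.induction_on with
  | ih p =>
    induction p using Polynomial.induction_on' with
    | add p q hp hq =>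
      obtain ⟨x, y, h⟩ := hp
      obtain ⟨z, w, h'⟩ := hq
      exact ⟨x + z, y + w, by rw [← elt_add, h, h', map_add]⟩
    | monomial n a =>
      induction n with
      | zero => exact ⟨a, 0, by simp [elt]⟩
      | succ n ih =>
        obtain ⟨x, y, h⟩ := ih
        refine ⟨x * 0 - y * 1, x * 1 + y * 0 - y * 1, ?_⟩
        rw [← elt_mul, h, ← Polynomial.monomial_mul_X, map_mul, AdjoinRoot.mk_X]
        simp [elt]

theorem elt_eq_zero {x y : ZMod 4} (h : elt x y = 0) : x = 0 ∧ y = 0 := by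
  have hm : (Polynomial.X ^ 2 + Polynomial.X + 1 : (ZMod 4)[X]).Monic := by monicity!
  have hdeg : (Polynomial.X ^ 2 + Polynomial.X + 1 : (ZMod 4)[X]).degree = 2 := by compute_degree!
  have h1 : AdjoinRoot.mk (Polynomial.X ^ 2 + Polynomial.X + 1 : (ZMod 4)[X])
      (Polynomial.C y * Polynomial.X + Polynomial.C x) = 0 := by
    rw [← h, elt, map_add, map_mul, AdjoinRoot.mk_C, AdjoinRoot.mk_C, AdjoinRoot.mk_X]
    exact add_comm _ _
  rw [AdjoinRoot.mk_eq_zero] at h1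
  have h2 : (Polynomial.C y * Polynomial.X + Polynomial.C x) = 0 := by
    by_contra h0
    refine hm.not_dvd_of_degree_lt h0 ?_ h1
    rw [hdeg]
    exact lt_of_le_of_lt Polynomial.degree_linear_le (by norm_num)
  have h3 := congrArg (fun p => p.coeff 0) h2
  have h4 := congrArg (fun p => p.coeff 1) h2
  simp at h3 h4
  exact ⟨h3, h4⟩

theorem elt_injective {x y z w : ZMod 4} (h : elt x y = elt z w) : x = z ∧ y = w := by
  have h1 : elt (x - z) (y - w) = 0 := by
    rw [← sub_eq_zero.2 h]; simp only [elt, map_sub]; ring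
  obtain ⟨h2, h3⟩ := elt_eq_zero h1
  exact ⟨sub_eq_zero.1 h2, sub_eq_zero.1 h3⟩

/-- The reduction modulo two. -/
noncomputable def π : G4 →+* K4 :=
  AdjoinRoot.lift (ZMod.castHom (show 2 ∣ 4 by norm_num) K4) K4.ω (by
    simp only [Polynomial.eval₂_add, Polynomial.eval₂_pow, Polynomial.eval₂_X,
      Polynomial.eval₂_one]
    decide)

theorem π_elt (x y : ZMod 4) : π (elt x y) = (x.cast : K4) + y.cast * K4.ω := by
  simp only [π, elt, map_add, map_mul, AdjoinRoot.lift_of, AdjoinRoot.lift_root, ZMod.castHom_apply]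

/-- The first coordinate of the Teichmüller representative. -/
def re (a : K4) : ZMod 4 := if a = 0 then 0 else if a = 1 then 1 else if a = K4.ω then 0 else 3

/-- The second coordinate of the Teichmüller representative. -/
def im (a : K4) : ZMod 4 := if a = 0 then 0 else if a = 1 then 0 else if a = K4.ω then 1 else 3

/-- The Teichmüller representative. -/
noncomputable def θ (a : K4) : G4 := elt (re a) (im a)

theorem π_θ (a : K4) : π (θ a) = a := by
  rw [θ, π_elt]; revert a; decide +kernel

/-- The entries 3 in `re` and `im` reflect ω² = −1 − ω. -/
theorem θ_mul (a b : K4) : θ a * θ b = θ (a * b) := by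
  have h : ∀ a b : K4, re a * re b - im a * im b = re (a * b) ∧
    re a * im b + im a * re b - im a * im b = im (a * b) := by decide +kernel
  rw [θ, θ, θ, elt_mul, (h a b).1, (h a b).2]

/-- The parametrization of the ideal generated by two. -/
noncomputable def ι : K4 →+ G4 where
  toFun b := elt (2 * re b) (2 * im b)
  map_zero' := by
    have h : 2 * re 0 = 0 ∧ 2 * im 0 = 0 := by decide +kernel
    rw [h.1, h.2]; simp [elt]
  map_add' a b := by
    have h : ∀ a b : K4, 2 * re (a + b) = 2 * re a + 2 * re b ∧
      2 * im (a + b) = 2 * im a + 2 * im b := by decide +kernel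
    rw [elt_add, (h a b).1, (h a b).2]

theorem ι_apply (b : K4) : ι b = elt (2 * re b) (2 * im b) := rfl

/-- The carry in Teichmüller addition is 2√(ab), and on 𝔽₄ the square root is the square. -/
theorem θ_add (a b : K4) : θ a + θ b = θ (a + b) + ι (a * a * (b * b)) := by
  have h : ∀ a b : K4, re a + re b = re (a + b) + 2 * re (a * a * (b * b)) ∧
    im a + im b = im (a + b) + 2 * im (a * a * (b * b)) := by decide +kernel
  rw [θ, θ, θ, ι_apply, elt_add, elt_add, (h a b).1, (h a b).2]

theorem mul_ι (r : G4) (b : K4) : r * ι b = ι (π r * b) := by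
  obtain ⟨x, y, rfl⟩ := elt_surjective r
  have h : ∀ x y : ZMod 4, ∀ b : K4,
      x * (2 * re b) - y * (2 * im b) = 2 * re ((x.cast + y.cast * K4.ω) * b) ∧
      x * (2 * im b) + y * (2 * re b) - y * (2 * im b) =
        2 * im ((x.cast + y.cast * K4.ω) * b) := by decide +kernel
  rw [ι_apply, elt_mul, π_elt, (h x y b).1, (h x y b).2, ι_apply]

/-- The chain ring data of the Galois ring. -/
noncomputable def data : ChainData G4 where
  π := π
  ι := ι
  σ := RingHom.id K4
  s := θ
  π_s := π_θ
  ι_injective a b h := by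
    have h1 : ∀ a b : K4, 2 * re a = 2 * re b → 2 * im a = 2 * im b → a = b := by decide +kernel
    exact h1 a b (elt_injective h).1 (elt_injective h).2
  π_ι b := by
    rw [ι_apply, π_elt]; revert b; decide +kernel
  exists_ι r hr := by
    obtain ⟨x, y, rfl⟩ := elt_surjective r
    have h : ∀ x y : ZMod 4, (x.cast : K4) + y.cast * K4.ω = 0 →
        ∃ b, 2 * re b = x ∧ 2 * im b = y := by decide +kernel
    rw [π_elt] at hr
    obtain ⟨b, h1, h2⟩ := h x y hr
    exact ⟨b, by rw [ι_apply, h1, h2]⟩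
  mul_ι := mul_ι
  ι_mul r b := by rw [mul_comm, mul_ι, mul_comm]; rfl
  σ_eq := Or.inl fun _ => rfl

/-- The carry of the inner product of Teichmüller vectors. -/
def carry (u v : V) : K4 :=
  u 2 * v 2 + u 0 * v 0 * (u 0 * v 0) * (u 1 * v 1 * (u 1 * v 1))

/-- By orthogonality the first two products add up to the third. Their Teichmüller sum gives one
carry, and doubling the third gives the other. -/
theorem pairing_eq (j i : Fin 21) (h : dot (rep j) (rep i) = 0) :
    data.pairing j i = carry (rep j) (rep i) := by
  have h0 : data.vec (rep j) 0 ⬝ᵥ data.vec (rep i) 0 = data.ι (carry (rep j) (rep i)) := by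
    simp only [dotProduct, Fin.sum_univ_three, ChainData.vec, Pi.zero_apply, map_zero, add_zero]
    change θ _ * θ _ + θ _ * θ _ + θ _ * θ _ = ι _
    have h2 : rep j 0 * rep i 0 + rep j 1 * rep i 1 = rep j 2 * rep i 2 :=
      CharTwo.add_eq_zero.1 h
    have h3 : ∀ a : K4, θ a + θ a = ι a := fun a => by
      rw [θ_add, CharTwo.add_self_eq_zero]
      have h4 : a * a * (a * a) = a := by revert a; decide
      have h5 : θ 0 = 0 := by simp [θ, elt, re, im]
      rw [h4, h5, zero_add]
    rw [θ_mul, θ_mul, θ_mul, θ_add, h2, add_right_comm, h3, ← map_add]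
    rfl
  rw [ChainData.pairing, h0, Function.leftInverse_invFun data.ι_injective]

/-- The radical part of the Teichmüller representatives of the cubic extension with
`s³ = ω`. -/
def lift (u : V) : V :=
  -- These are the coordinates of √(xy) + √(xz) + √(yz) for x = u₀, y = u₁s, z = u₂s², with √s = ωs²
  -- and √ω = ω².
  ![K4.ω * K4.ω * (u 1 * u 1 * (u 2 * u 2)), u 0 * u 0 * (u 2 * u 2),
    K4.ω * (u 0 * u 0 * (u 1 * u 1))]

/-- Concurrency would make carry plus lift respect the linear relation, whatever `y` is.
Conceptually, the Teichmüller units of x, y and x + y leave the term 2√(xy), and √(xy) = ax + by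
would make x/y a root of a quadratic over 𝔽₄, while it has degree three. -/
theorem no_three_concurrent : ∀ i j, dot (rep j) (rep i) = 0 → ∀ k, j ≠ k →
    dot (rep k) (rep i) = 0 → ∀ l, j ≠ l → k ≠ l → dot (rep l) (rep i) = 0 →
    ∃ a b : K4, rep l = a • rep j + b • rep k ∧
      carry (rep l) (rep i) + dot (lift (rep l)) (rep i) ≠
        a * (carry (rep j) (rep i) + dot (lift (rep j)) (rep i)) +
        b * (carry (rep k) (rep i) + dot (lift (rep k)) (rep i)) := by
  decide +kernel

theorem exists_isDualHyperoval : ∃ H, IsDualHyperoval G4 H := by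
  have := Fintype.ofFinite (Point G4)
  have := Fintype.ofFinite (Line G4)
  have hτ : ∀ i, data.τ i = i := fun i => rep_injective (funext fun k => by
    rw [← data.σ_rep]; rfl)
  refine data.coordinates.dual.isArc_of_no_three_collinear (fun j => lift (rep j))
    fun j k l hjk hjl hkl x ⟨h1, h2, h3⟩ => ?_
  obtain ⟨⟨i, y⟩, rfl⟩ := data.pt_surjective x
  have hinc : ∀ j, Inc G4 (data.pt (i, y)) (data.coordinates.dual.pt (j, lift (rep j))) →
      dot (rep j) (rep i) = 0 ∧
        dot (rep j) y = carry (rep j) (rep i) + dot (lift (rep j)) (rep i) := by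
    intro j h
    change Inc G4 (data.pt (i, y)) (data.ln (data.τ j, _)) at h
    rw [data.inc_iff, hτ, hτ] at h
    refine ⟨h.1, ?_⟩
    rw [← pairing_eq j i h.1, ← h.2, CharTwo.add_cancel_right]
  obtain ⟨o1, e1⟩ := hinc j h1
  obtain ⟨o2, e2⟩ := hinc k h2
  obtain ⟨o3, e3⟩ := hinc l h3
  obtain ⟨a, b, hab, hne⟩ := no_three_concurrent i j o1 k hjk o2 l hjl hkl o3
  apply hne
  rw [← e1, ← e2, ← e3, hab, add_dot, smul_dot, smul_dot]

end Galois

end Hjelmslev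

theorem mainTheorem11 :
    (Hjelmslev.m 8 Hjelmslev.S4 ≤ 125 ∧ Hjelmslev.m 8 Hjelmslev.T4 ≤ 125) ∧
    Hjelmslev.m 8 Hjelmslev.G4 = 126 ∧
    (Hjelmslev.ArcsAreDualHyperovals Hjelmslev.S4 ∧
      Hjelmslev.ArcsAreDualHyperovals Hjelmslev.T4 ∧
      Hjelmslev.ArcsAreDualHyperovals Hjelmslev.G4) ∧
    (¬ ∃ H : Hjelmslev.Line Hjelmslev.S4 → ℕ, Hjelmslev.IsDualHyperoval Hjelmslev.S4 H) ∧
    (¬ ∃ H : Hjelmslev.Line Hjelmslev.T4 → ℕ, Hjelmslev.IsDualHyperoval Hjelmslev.T4 H) := by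
  obtain ⟨D, hD⟩ := Hjelmslev.exists_chainData_S4
  obtain ⟨E, hE⟩ := Hjelmslev.exists_chainData_T4
  obtain ⟨H, hH⟩ := Hjelmslev.Galois.exists_isDualHyperoval
  have hS := D.not_exists_isDualHyperoval hD
  have hT := E.not_exists_isDualHyperoval hE
  exact ⟨⟨D.m_eight_le_of_not_exists hS, E.m_eight_le_of_not_exists hT⟩,
    Hjelmslev.Galois.data.m_eight_eq_of_isDualHyperoval hH,
    ⟨D.arcsAreDualHyperovals, E.arcsAreDualHyperovals,
      Hjelmslev.Galois.data.arcsAreDualHyperovals⟩, hS, hT⟩
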